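/- Let $\mathbb D\in\{\mathbb R,\mathbb C,\mathbb H\}$ ($\mathbb H$ the quaternions) and let $\mathsf H$ be a Hilbert space over $\mathbb D$, not necessarily separable, with scalars acting on the right and scalar product $\langle\cdot|\cdot\rangle$ which is Hermitian, positive definite and $\mathbb D$-linear in the right entry. Let $\mathfrak B(\mathsf H)$ be the set of bounded right-$\mathbb D$-linear operators on $\mathsf H$, with operator norm $\|\cdot\|$ and adjoint $A\mapsto A^*$; it is a real algebra, with $(aA)(x)=(Ax)a$, and a complex one if $\mathbb D=\mathbb C$. For $T\in\mathfrak B(\mathsf H)$ let $|T|=\sqrt{T^*T}$ be the unique positive selfadjoint operator with $|T|\,|T|=T^*T$. Let $\sigma_p(|T|)$ be the point spectrum of $|T|$; if $\mathbb D=\mathbb H$ this means the spherical point spectrum, that is, the set of $q\in\mathbb H$ for which $|T|^2-|T|(q+\bar q)+|q|^2I$ is not injective. Say that $T$ is of trace class, $T\in\mathfrak B_1(\mathsf H)$, if $$\sum_{u\in N}\langle u\,|\,|T|u\rangle<+\infty \qquad (1)$$ for some Hilbert basis $N\subset\mathsf H$. Then the following hold. (a) If $T\in\mathfrak B_1(\mathsf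 H)$, then (1) holds for every Hilbert basis $M\subset\mathsf H$ in place of $N$, and $\sum_{u\in M}\langle u||T|u\rangle$ does not depend on $M$. (b) $T\in\mathfrak B_1(\mathsf H)$ if and only if (i) $T$ is compact and (ii) $$\|T\|_1:=\sum_{s\in\sigma_p(|T|)} s\,d_s<+\infty ,$$ where $d_s$ is the dimension of the $s$-eigenspace of $|T|$ and $0\cdot\infty=0$. Here, for compact $T$, $\sigma_p(|T|)\subset[0,+\infty)$ and $d_s\ge 1$ for every $s\in\sigma_p(|T|)$, with $d_s<\infty$ if $s\neq0$. (c) If $T\in\mathfrak B_1(\mathsf H)$, then $\|T\|_1=\sum_{u\in M}\langle u||T|u\rangle$ for every Hilbert basis $M\subset\mathsf H$. (d) $\mathfrak B_1(\mathsf H)$ is (i) an $\mathbb R$-linear subspace of $\mathfrak B(\mathsf H)$, and a $\mathbb C$-linear one if $\mathbb D=\mathbb C$; (ii) a two-sided $^*$-ideal of $\mathfrak B(\mathsf H)$; (iii) a real Banach space with respect to the norm $\|\cdot\|_1$. (e) For $A\in\mathfrak B_1(\mathsf H)$ and $B\in\mathfrak B(\mathsf H)$: (i) $\|AB\|_1\le\|A\|_1\|B\|$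 and $\|BA\|_1\le\|A\|_1\|B\|$; (ii) $\|A\|_1=\|A^*\|_1$; (iii) $\|A\|\le\|A\|_1$. Hence $\mathfrak B_1(\mathsf H)$ with the norm $\|\cdot\|_1$ is a real Banach algebra (a complex one if $\mathbb D=\mathbb C$), not necessarily unital, which is also a $^*$-algebra, and the norm is $^*$-invariant. -/

import Mathlib

open scoped Quaternion ENNReal
open MulOpposite

namespace RCH

/-! ### The scalars: the real, complex or quaternionic division algebra -/

/-- `D` is (a copy of) one of the three real `*`-algebras `ℝ`, `ℂ`, `ℍ`. -/
class IsScalar (D : Type*) [DivisionRing D] [StarRing D] [Algebra ℝ D] : Prop where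
  iso : Nonempty (D ≃⋆ₐ[ℝ] ℝ) ∨ Nonempty (D ≃⋆ₐ[ℝ] ℂ) ∨ Nonempty (D ≃⋆ₐ[ℝ] ℍ[ℝ])

instance : IsScalar ℝ := ⟨Or.inl ⟨StarAlgEquiv.refl ℝ _⟩⟩
instance : IsScalar ℂ := ⟨Or.inr (Or.inl ⟨StarAlgEquiv.refl ℝ _⟩)⟩
instance : IsScalar ℍ[ℝ] := ⟨Or.inr (Or.inr ⟨StarAlgEquiv.refl ℝ _⟩)⟩

theorem algebraMap_inj {D : Type*} [DivisionRing D] [Algebra ℝ D] {r s : ℝ} :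
    algebraMap ℝ D r = algebraMap ℝ D s ↔ r = s :=
  (algebraMap ℝ D).injective.eq_iff

section Scalars

variable {D : Type*} [DivisionRing D] [StarRing D] [Algebra ℝ D] [IsScalar D]

theorem exists_half_add_star (d : D) :
    ∃ r : ℝ, algebraMap ℝ D r = (1 / 2 : ℝ) • (d + star d) := by
  rcases IsScalar.iso (D := D) with ⟨⟨e⟩⟩ | ⟨⟨e⟩⟩ | ⟨⟨e⟩⟩
  · refine ⟨e d, (EquivLike.injective e) ?_⟩
    have h1 : e (algebraMap ℝ D (e d)) = algebraMap ℝ ℝ (e d) :=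
      AlgHomClass.commutes e (e d)
    rw [h1, map_smul, map_add, map_star]
    simp
    ring
  · refine ⟨(e d).re, (EquivLike.injective e) ?_⟩
    have h1 : e (algebraMap ℝ D (e d).re) = algebraMap ℝ ℂ (e d).re :=
      AlgHomClass.commutes e _
    rw [h1, map_smul, map_add, map_star]
    apply Complex.ext <;> simp
    ring
  · refine ⟨(e d).re, (EquivLike.injective e) ?_⟩
    have h1 : e (algebraMap ℝ D (e d).re) = algebraMap ℝ ℍ[ℝ] (e d).re :=
      AlgHomClass.commutes e _
    rw [h1, map_smul, map_add, map_star]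
    rw [Quaternion.self_add_star', Quaternion.algebraMap_def]
    ext <;> simp

theorem exists_star_mul_self (d : D) :
    ∃ r : ℝ, 0 ≤ r ∧ star d * d = algebraMap ℝ D r := by
  rcases IsScalar.iso (D := D) with ⟨⟨e⟩⟩ | ⟨⟨e⟩⟩ | ⟨⟨e⟩⟩
  · refine ⟨e d * e d, mul_self_nonneg _, (EquivLike.injective e) ?_⟩
    have h1 : e (algebraMap ℝ D (e d * e d)) = algebraMap ℝ ℝ (e d * e d) :=
      AlgHomClass.commutes e _
    rw [h1, map_mul, map_star]
    simp
  · refine ⟨Complex.normSq (e d), Complex.normSq_nonneg _, (EquivLike.injective e) ?_⟩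
    have h1 : e (algebraMap ℝ D (Complex.normSq (e d))) = algebraMap ℝ ℂ (Complex.normSq (e d)) :=
      AlgHomClass.commutes e _
    rw [h1, map_mul, map_star]
    simpa using (Complex.normSq_eq_conj_mul_self (z := e d)).symm
  · refine ⟨Quaternion.normSq (e d), Quaternion.normSq_nonneg, (EquivLike.injective e) ?_⟩
    have h1 : e (algebraMap ℝ D (Quaternion.normSq (e d)))
        = algebraMap ℝ ℍ[ℝ] (Quaternion.normSq (e d)) :=
      AlgHomClass.commutes e _
    rw [h1, map_mul, map_star]
    simpa using (Quaternion.star_mul_self (a := e d))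

/-- The real part `Re q = (q + q̄) / 2`, as a real number. -/
noncomputable def re (d : D) : ℝ := Classical.choose (exists_half_add_star d)

theorem algebraMap_re (d : D) : algebraMap ℝ D (re d) = (1 / 2 : ℝ) • (d + star d) :=
  Classical.choose_spec (exists_half_add_star d)

theorem star_algebraMap (r : ℝ) : star (algebraMap ℝ D r) = algebraMap ℝ D r := by
  have key : ∀ {E : Type} [Ring E] [StarRing E] [Algebra ℝ E] (e : D ≃⋆ₐ[ℝ] E),
      star (algebraMap ℝ E r) = algebraMap ℝ E r →
        star (algebraMap ℝ D r) = algebraMap ℝ D r := by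
    intro E _ _ _ e h
    apply (EquivLike.injective e)
    have h1 : e (algebraMap ℝ D r) = algebraMap ℝ E r := AlgHomClass.commutes e r
    rw [map_star, h1, h]
  rcases IsScalar.iso (D := D) with ⟨⟨e⟩⟩ | ⟨⟨e⟩⟩ | ⟨⟨e⟩⟩
  · exact key e (by simp)
  · exact key e (by simp)
  · exact key e (by rw [Quaternion.algebraMap_def]; exact Quaternion.star_coe r)

theorem re_eq_iff {d : D} {r : ℝ} : re d = r ↔ algebraMap ℝ D r = (1 / 2 : ℝ) • (d + star d) := by
  rw [← algebraMap_re, algebraMap_inj, eq_comm]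

theorem re_algebraMap (r : ℝ) : re (algebraMap ℝ D r) = r := by
  rw [re_eq_iff, star_algebraMap, ← two_smul ℝ (algebraMap ℝ D r), smul_smul]
  norm_num

theorem re_add (p q : D) : re (p + q) = re p + re q := by
  rw [re_eq_iff, map_add, algebraMap_re, algebraMap_re, ← smul_add, star_add]
  congr 1
  abel

theorem re_star (p : D) : re (star p) = re p := by
  rw [re_eq_iff, algebraMap_re, star_star, add_comm]

theorem star_real_smul (r : ℝ) (p : D) : star (r • p) = r • star p := by
  rw [Algebra.smul_def, star_mul, star_algebraMap, Algebra.smul_def, Algebra.commutes]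

theorem re_smul (r : ℝ) (p : D) : re (r • p) = r * re p := by
  rw [re_eq_iff, map_mul, algebraMap_re, star_real_smul, ← smul_add, ← Algebra.smul_def]
  exact smul_comm _ _ _

theorem re_neg (p : D) : re (-p) = -re p := by
  have := re_smul (-1) p
  simpa using this

theorem re_sub (p q : D) : re (p - q) = re p - re q := by
  rw [sub_eq_add_neg, re_add, re_neg, sub_eq_add_neg]

theorem eq_zero_of_re_mul {d : D} (h : ∀ q : D, re (d * q) = 0) : d = 0 := by
  obtain ⟨r, -, hr⟩ := exists_star_mul_self (star d)
  rw [star_star] at hr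
  have h1 := h (star d)
  rw [hr, re_algebraMap] at h1
  rw [h1, map_zero] at hr
  rcases mul_eq_zero.1 hr with h2 | h2
  · exact h2
  · simpa using h2

end Scalars

/-! ### The absolute value of an operator on a real Hilbert space -/

/-- The iteration `Y ↦ (X + Y ^ 2) / 2`, whose limit `Y` satisfies `(1 - Y) ^ 2 = 1 - X`. -/
noncomputable def sqIter {A : Type*} [NormedRing A] [NormedAlgebra ℝ A] (X : A) : ℕ → A
  | 0 => 0
  | n + 1 => (1 / 2 : ℝ) • (X + sqIter X n * sqIter X n)

theorem sqIter_commute {A : Type*} [NormedRing A] [NormedAlgebra ℝ A] {X C : A}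
    (h : Commute C X) (n : ℕ) : Commute C (sqIter X n) := by
  induction n with
  | zero => exact Commute.zero_right C
  | succ n ih => exact (h.add_right (ih.mul_right ih)).smul_right _

theorem sqIter_one_bound (n : ℕ) :
    0 ≤ sqIter (1 : ℝ) n ∧ sqIter (1 : ℝ) n ≤ 1 ∧ sqIter (1 : ℝ) n ≤ sqIter (1 : ℝ) (n + 1) := by
  have hs : ∀ n, sqIter (1 : ℝ) (n + 1)
      = 1 / 2 * (1 + sqIter (1 : ℝ) n * sqIter (1 : ℝ) n) := fun n => rfl
  have h01 : 0 ≤ sqIter (1 : ℝ) n ∧ sqIter (1 : ℝ) n ≤ 1 := by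
    induction n with
    | zero => exact ⟨le_refl _, zero_le_one⟩
    | succ n ih => rw [hs]; constructor <;> nlinarith [ih.1, ih.2]
  refine ⟨h01.1, h01.2, ?_⟩
  rw [hs]
  nlinarith [sq_nonneg (sqIter (1 : ℝ) n - 1)]

theorem sqIter_norm {A : Type*} [NormedRing A] [NormedAlgebra ℝ A] {X : A} (hX : ‖X‖ ≤ 1)
    (n : ℕ) : ‖sqIter X n‖ ≤ sqIter (1 : ℝ) n ∧
      ‖sqIter X (n + 1) - sqIter X n‖ ≤ sqIter (1 : ℝ) (n + 1) - sqIter (1 : ℝ) n := by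
  have hs : ∀ n, sqIter (1 : ℝ) (n + 1)
      = 1 / 2 * (1 + sqIter (1 : ℝ) n * sqIter (1 : ℝ) n) := fun n => rfl
  have hsX : ∀ n, sqIter X (n + 1) = (1 / 2 : ℝ) • (X + sqIter X n * sqIter X n) := fun n => rfl
  have h1 : ∀ n, ‖sqIter X n‖ ≤ sqIter (1 : ℝ) n := by
    intro n
    induction n with
    | zero => simp [sqIter]
    | succ n ih =>
      rw [hs, hsX, norm_smul]
      have h2 := (norm_add_le X (sqIter X n * sqIter X n)).trans
        (add_le_add hX (norm_mul_le (sqIter X n) (sqIter X n)))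
      have h3 := mul_le_mul ih ih (norm_nonneg _) (sqIter_one_bound n).1
      norm_num
      linarith
  refine ⟨h1 n, ?_⟩
  induction n with
  | zero => simp [sqIter, norm_smul]; linarith
  | succ n ih =>
    have hc : Commute (sqIter X n) (sqIter X (n + 1)) :=
      (sqIter_commute (sqIter_commute (Commute.refl X) n).symm (n + 1))
    have e : sqIter X (n + 1 + 1) - sqIter X (n + 1)
        = (1 / 2 : ℝ) • ((sqIter X (n + 1) + sqIter X n) * (sqIter X (n + 1) - sqIter X n)) := by
      rw [hsX (n + 1), hsX n, ← smul_sub, ← hsX n]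
      congr 1
      rw [add_mul, mul_sub, mul_sub, hc.eq]
      abel
    rw [e, norm_smul, hs (n + 1), hs n, ← hs n]
    have h2 := (norm_mul_le (sqIter X (n + 1) + sqIter X n) (sqIter X (n + 1) - sqIter X n)).trans
      (mul_le_mul ((norm_add_le _ _).trans (add_le_add (h1 (n + 1)) (h1 n))) ih (norm_nonneg _)
        (add_nonneg (sqIter_one_bound (n + 1)).1 (sqIter_one_bound n).1))
    norm_num
    have h3 := hs n
    nlinarith

theorem sqIter_tendsto {A : Type*} [NormedRing A] [NormedAlgebra ℝ A] [CompleteSpace A] {X : A}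
    (hX : ‖X‖ ≤ 1) : ∃ Y : A, Filter.Tendsto (sqIter X) Filter.atTop (nhds Y) ∧ ‖Y‖ ≤ 1 ∧
      Y = (1 / 2 : ℝ) • (X + Y * Y) := by
  have hsum : Summable fun n => sqIter (1 : ℝ) (n + 1) - sqIter (1 : ℝ) n := by
    refine summable_of_sum_range_le (c := 1) (fun n => sub_nonneg.2 (sqIter_one_bound n).2.2) ?_
    intro n
    rw [Finset.sum_range_sub]
    have : sqIter (1 : ℝ) 0 = 0 := rfl
    rw [this, sub_zero]
    exact (sqIter_one_bound n).2.1
  have hc : CauchySeq (sqIter X) := by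
    refine cauchySeq_of_dist_le_of_summable _ (fun n => ?_) hsum
    rw [dist_comm, dist_eq_norm]
    exact (sqIter_norm hX n).2
  obtain ⟨Y, hY⟩ := cauchySeq_tendsto_of_complete hc
  refine ⟨Y, hY, ?_, ?_⟩
  · exact le_of_tendsto hY.norm (Filter.Eventually.of_forall fun n =>
      (sqIter_norm hX n).1.trans (sqIter_one_bound n).2.1)
  · refine tendsto_nhds_unique ((Filter.tendsto_add_atTop_iff_nat 1).2 hY) ?_
    exact (tendsto_const_nhds.add (hY.mul hY)).const_smul (1 / 2 : ℝ)

open ContinuousLinearMap in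
theorem exists_real_abs {E : Type*} [NormedAddCommGroup E] [InnerProductSpace ℝ E]
    [CompleteSpace E] (T : E →L[ℝ] E) : ∃ S : E →L[ℝ] E, adjoint S = S ∧
      (∀ x, 0 ≤ inner ℝ x (S x)) ∧ S * S = adjoint T * T ∧
      ∀ C, Commute C (adjoint T * T) → Commute C S := by
  rcases eq_or_ne T 0 with rfl | hT
  · exact ⟨0, by simp, by simp, by simp, fun C _ => Commute.zero_right C⟩
  have hc : 0 < ‖T‖ := norm_pos_iff.2 hT
  set c := ‖T‖ with hcdef
  set B : E →L[ℝ] E := adjoint T * T with hB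
  have hBs : adjoint B = B := by
    change adjoint (adjoint T ∘L T) = adjoint T ∘L T
    rw [adjoint_comp, adjoint_adjoint]
  set X : E →L[ℝ] E := 1 - (c ^ 2)⁻¹ • B with hXdef
  have hX : ‖X‖ ≤ 1 := by
    refine opNorm_le_bound _ zero_le_one fun x => ?_
    rw [one_mul]
    refine le_of_sq_le_sq ?_ (norm_nonneg _)
    have e : X x = x - (c ^ 2)⁻¹ • B x := rfl
    have e1 : inner ℝ x (B x) = ‖T x‖ ^ 2 := by
      rw [← real_inner_self_eq_norm_sq]; exact adjoint_inner_right T x (T x)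
    have e2 : ‖B x‖ ≤ c * ‖T x‖ := by
      have := (adjoint T).le_opNorm (T x)
      rwa [LinearIsometryEquiv.norm_map] at this
    have e3 : ‖B x‖ ^ 2 ≤ c ^ 2 * ‖T x‖ ^ 2 := by
      rw [← mul_pow]; exact pow_le_pow_left₀ (norm_nonneg _) e2 2
    rw [e, norm_sub_sq_real, inner_smul_right, e1, norm_smul, mul_pow, Real.norm_eq_abs, sq_abs]
    have hp : 0 < (c ^ 2)⁻¹ := by positivity
    have e4 : ((c ^ 2)⁻¹) ^ 2 * ‖B x‖ ^ 2 ≤ (c ^ 2)⁻¹ * ‖T x‖ ^ 2 := by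
      calc ((c ^ 2)⁻¹) ^ 2 * ‖B x‖ ^ 2 ≤ ((c ^ 2)⁻¹) ^ 2 * (c ^ 2 * ‖T x‖ ^ 2) := by gcongr
        _ = (c ^ 2)⁻¹ * ‖T x‖ ^ 2 := by field_simp
    have e5 : 0 ≤ (c ^ 2)⁻¹ * ‖T x‖ ^ 2 := by positivity
    linarith
  have hXs : adjoint X = X := by
    rw [hXdef, map_sub, map_smul, hBs]
    congr 1
    exact adjoint_id
  obtain ⟨Y, hY, hY1, hYe⟩ := sqIter_tendsto hX
  have hYs : adjoint Y = Y := by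
    refine tendsto_nhds_unique ((adjoint.continuous.tendsto Y).comp hY) ?_
    refine hY.congr fun n => ?_
    symm
    induction n with
    | zero => exact map_zero _
    | succ n ih =>
      change adjoint ((1 / 2 : ℝ) • (X + sqIter X n * sqIter X n))
        = (1 / 2 : ℝ) • (X + sqIter X n * sqIter X n)
      have ih' : adjoint (sqIter X n) = sqIter X n := ih
      rw [map_smul, map_add, hXs]
      congr 2
      change adjoint (sqIter X n ∘L sqIter X n) = _
      rw [adjoint_comp, ih']
      rfl
  have hYC : ∀ C, Commute C B → Commute C Y := by
    intro C hC
    have hCX : Commute C X := (Commute.one_right C).sub_right (hC.smul_right _)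
    exact tendsto_nhds_unique (hY.const_mul C)
      ((hY.mul_const C).congr fun n => (sqIter_commute hCX n).eq.symm)
  refine ⟨c • (1 - Y), ?_, ?_, ?_, ?_⟩
  · rw [map_smul, map_sub, hYs]
    congr 2
    exact adjoint_id
  · intro x
    have e : (c • (1 - Y)) x = c • (x - Y x) := rfl
    rw [e, inner_smul_right, inner_sub_right, real_inner_self_eq_norm_sq]
    have h1 : inner ℝ x (Y x) ≤ ‖x‖ * ‖Y x‖ := real_inner_le_norm _ _
    have h2 : ‖Y x‖ ≤ ‖x‖ := (Y.le_opNorm x).trans (mul_le_of_le_one_left (norm_nonneg _) hY1)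
    refine mul_nonneg hc.le ?_
    nlinarith [norm_nonneg x]
  · have h1 : Y * Y = Y + Y - X := by
      have h2 : (2 : ℝ) • Y = X + Y * Y := by
        conv_lhs => rw [hYe]
        rw [smul_smul]; norm_num
      rw [← two_smul ℝ Y, h2]; abel
    have h3 : (1 - Y) * (1 - Y) = (c ^ 2)⁻¹ • B := by
      have : (1 - Y) * (1 - Y) = 1 - Y - Y + Y * Y := by noncomm_ring
      rw [this, h1, hXdef]; abel
    rw [smul_mul_smul_comm, h3, smul_smul]
    have : c * c * (c ^ 2)⁻¹ = 1 := by field_simp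
    rw [this, one_smul]
  · intro C hC
    exact ((Commute.one_right C).sub_right (hYC C hC)).smul_right _

open ContinuousLinearMap in
theorem real_sqrt_unique {E : Type*} [NormedAddCommGroup E] [InnerProductSpace ℝ E]
    [CompleteSpace E] {B S R : E →L[ℝ] E} (hS : adjoint S = S) (hS0 : ∀ x, 0 ≤ inner ℝ x (S x))
    (hSB : S * S = B) (hSC : ∀ C, Commute C B → Commute C S)
    (hR : adjoint R = R) (hR0 : ∀ x, 0 ≤ inner ℝ x (R x)) (hRB : R * R = B) : R = S := by
  have hc : Commute R S := hSC R (by rw [← hRB]; exact (Commute.refl R).mul_right (Commute.refl R))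
  have h0 : (S + R) * (R - S) = 0 := by
    rw [add_mul, mul_sub, mul_sub, hSB, hRB, hc.eq]; abel
  have hx : ∀ x, (R - S) x = 0 := by
    intro x
    set y := (R - S) x with hy
    have h1 : S y + R y = 0 := congrArg (fun F : E →L[ℝ] E => F x) h0
    have h2 : inner ℝ y (S y) + inner ℝ y (R y) = 0 := by rw [← inner_add_right, h1, inner_zero_right]
    have hz : ∀ F : E →L[ℝ] E, adjoint F = F → (∀ x, 0 ≤ inner ℝ x (F x)) →
        inner ℝ y (F y) = 0 → F y = 0 := by
      intro F hF hF0 hFy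
      by_contra hne
      have hq : ∀ t : ℝ, 0 ≤ inner ℝ (F y) (F (F y)) * (t * t) + 2 * ‖F y‖ ^ 2 * t + 0 := by
        intro t
        have h := hF0 (y + t • F y)
        have hsym : inner ℝ y (F (F y)) = ‖F y‖ ^ 2 := by
          have := adjoint_inner_left F (F y) y
          rw [hF] at this
          rw [← this, real_inner_self_eq_norm_sq]
        rw [map_add, map_smul, inner_add_left, inner_add_right, inner_add_right, hFy,
          inner_smul_right, inner_smul_left, inner_smul_left, inner_smul_right, hsym,
          real_inner_self_eq_norm_sq] at h
        simp only [conj_trivial] at h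
        linarith
      have := discrim_le_zero hq
      unfold discrim at this
      have h5 : 0 < ‖F y‖ ^ 2 := by positivity
      nlinarith
    have hSy := hz S hS hS0 (by linarith [hS0 y, hR0 y])
    have hRy := hz R hR hR0 (by linarith [hS0 y, hR0 y])
    have h6 : inner ℝ y y = 0 := by
      have e : inner ℝ y y = inner ℝ x ((R - S) y) := by
        have := adjoint_inner_right (R - S) x y
        rw [map_sub, hR, hS] at this
        exact this.symm
      rw [e]
      change inner ℝ x (R y - S y) = 0
      rw [hSy, hRy]; simp
    exact inner_self_eq_zero.1 h6
  ext x
  exact sub_eq_zero.1 (hx x)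

/-! ### Hilbert spaces over `D` with scalars acting on the right -/

/-- A `D`-valued scalar product on `H`, which makes `H` a Hilbert space over `D` when `H` is
complete. The right scalar multiplication `x q` is `op q • x`, the scalar product `⟨x|y⟩` is
`inner D x y`, linear in the right entry, and `‖x‖ = √⟨x|x⟩`. The real structure of `H` is the one
coming from `ℝ ⊆ D`. -/
class RightInnerProductSpace (D : Type*) [DivisionRing D] [StarRing D] [Algebra ℝ D]
    (H : Type*) [NormedAddCommGroup H] [NormedSpace ℝ H] [Module Dᵐᵒᵖ H]
    extends Inner D H, IsScalarTower ℝ Dᵐᵒᵖ H where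
  rinner_add : ∀ x y z : H, inner x (y + z) = inner x y + inner x z
  rinner_smul : ∀ (x y : H) (q : D), inner x (op q • y) = inner x y * q
  star_rinner : ∀ x y : H, star (inner x y) = inner y x
  rinner_self : ∀ x : H, inner x x = algebraMap ℝ D (‖x‖ ^ 2)

section Hilbert

variable {D : Type*} [DivisionRing D] [StarRing D] [Algebra ℝ D]
variable {H : Type*} [NormedAddCommGroup H] [NormedSpace ℝ H] [Module Dᵐᵒᵖ H]
  [RightInnerProductSpace D H]

open RightInnerProductSpace

theorem rinner_add_left (x y z : H) : inner D (x + y) z = inner D x z + inner D y z := by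
  rw [← star_rinner, rinner_add, star_add, star_rinner, star_rinner]

theorem rinner_smul_left (x y : H) (q : D) : inner D (op q • x) y = star q * inner D x y := by
  rw [← star_rinner, rinner_smul, star_mul, star_rinner]

theorem real_smul_eq (r : ℝ) (x : H) : r • x = op (algebraMap ℝ D r) • x := by
  have h : op (algebraMap ℝ D r) = r • (1 : Dᵐᵒᵖ) := by
    rw [Algebra.algebraMap_eq_smul_one]; rfl
  rw [h, smul_assoc, one_smul]

variable [IsScalar D]

theorem rinner_real_smul_left (x y : H) (r : ℝ) : inner D (r • x) y = r • inner D x y := by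
  rw [real_smul_eq (D := D), rinner_smul_left, star_algebraMap, Algebra.smul_def]

theorem norm_smul_sq (x : H) (q : D) : ‖op q • x‖ ^ 2 = ‖x‖ ^ 2 * re (star q * q) := by
  obtain ⟨r, -, hr⟩ := exists_star_mul_self q
  rw [hr, re_algebraMap, ← algebraMap_inj (D := D), ← rinner_self, rinner_smul,
    rinner_smul_left, rinner_self, mul_assoc, Algebra.commutes, ← mul_assoc, hr, map_mul,
    Algebra.commutes]

instance : ContinuousConstSMul Dᵐᵒᵖ H where
  continuous_const_smul q := by
    let f : H →+ H :=
      { toFun := fun x => q • x, map_zero' := smul_zero q, map_add' := smul_add q }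
    have hf : ∀ x, ‖f x‖ ≤ Real.sqrt (re (star q.unop * q.unop)) * ‖x‖ := by
      intro x
      have h := norm_smul_sq (D := D) x q.unop
      have h2 : ‖f x‖ = Real.sqrt (‖x‖ ^ 2 * re (star q.unop * q.unop)) := by
        rw [← h, Real.sqrt_sq (norm_nonneg _)]; rfl
      rw [h2, Real.sqrt_mul (sq_nonneg _), Real.sqrt_sq (norm_nonneg _), mul_comm]
    exact AddMonoidHomClass.continuous_of_bound f _ hf

variable (D) in
/-- The real inner product space underlying `H`, with scalar product `(x|y) = Re ⟨x|y⟩`. -/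
@[reducible] noncomputable def realInner : InnerProductSpace ℝ H where
  inner x y := re (inner D x y)
  norm_sq_eq_re_inner x := by
    simp only [rinner_self, re_algebraMap]; rfl
  conj_inner_symm x y := by
    change re (inner D y x) = re (inner D x y)
    rw [← star_rinner x y, re_star]
  add_left x y z := by
    change re (inner D (x + y) z) = re (inner D x z) + re (inner D y z)
    rw [rinner_add_left, re_add]
  smul_left x y r := by
    change re (inner D (r • x) y) = r * re (inner D x y)
    rw [rinner_real_smul_left, re_smul]

theorem rinner_ext_left {x y : H} (h : ∀ z : H, inner D x z = inner D y z) : x = y := by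
  let := realInner D (H := H)
  refine ext_inner_right ℝ fun z => ?_
  change re (inner D x z) = re (inner D y z)
  rw [h]

theorem eq_of_re_inner {x y x' y' : H}
    (h : ∀ q : D, re (inner D x (op q • y)) = re (inner D x' (op q • y'))) :
    inner D x y = inner D x' y' := by
  rw [← sub_eq_zero]
  refine eq_zero_of_re_mul fun q => ?_
  rw [sub_mul, re_sub, ← rinner_smul, ← rinner_smul, h, sub_self]

/-! ### Bounded operators -/

/-- `𝔅(H)`: the bounded (equivalently continuous) right-`D`-linear operators on `H`. -/
abbrev Op (D H : Type*) [DivisionRing D] [NormedAddCommGroup H] [Module Dᵐᵒᵖ H] : Type _ :=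
  H →L[Dᵐᵒᵖ] H

/-- The operator norm. -/
noncomputable def opNorm (T : Op D H) : ℝ := ‖T.restrictScalars ℝ‖

variable [CompleteSpace H]

theorem existsUnique_adjoint (T : Op D H) :
    ∃! S : Op D H, ∀ x y, inner D (S x) y = inner D x (T y) := by
  let := realInner D (H := H)
  let A : H →L[ℝ] H := ContinuousLinearMap.adjoint (T.restrictScalars ℝ)
  have hA : ∀ x y, inner D (A x) y = inner D x (T y) := by
    intro x y
    refine eq_of_re_inner fun q => ?_
    rw [← map_smul]
    exact ContinuousLinearMap.adjoint_inner_left (T.restrictScalars ℝ) (op q • y) x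
  refine ⟨⟨⟨⟨A, map_add A⟩, ?_⟩, A.continuous⟩, hA, ?_⟩
  · intro q x
    refine rinner_ext_left (D := D) fun z => ?_
    change inner D (A (q • x)) z = inner D (q • A x) z
    have h1 : q • x = op q.unop • x := rfl
    have h2 : q • A x = op q.unop • A x := rfl
    rw [h1, h2, hA, rinner_smul_left, rinner_smul_left, hA]
  · intro S hS
    ext x
    refine rinner_ext_left (D := D) fun z => ?_
    rw [hS]
    exact (hA x z).symm

/-- The Hermitian adjoint `T^*`: the operator with `⟨T^* x|y⟩ = ⟨x|T y⟩`. -/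
noncomputable def adjoint (T : Op D H) : Op D H := (existsUnique_adjoint T).choose

theorem adjoint_inner_left (T : Op D H) (x y : H) :
    inner D (adjoint T x) y = inner D x (T y) := (existsUnique_adjoint T).choose_spec.1 x y

/-- `⟨u|T u⟩` is a real number `≥ 0` for every `u`. -/
def IsPositive (T : Op D H) : Prop :=
  ∀ u : H, ∃ r : ℝ, 0 ≤ r ∧ inner D u (T u) = algebraMap ℝ D r

theorem existsUnique_abs (T : Op D H) :
    ∃! S : Op D H, adjoint S = S ∧ IsPositive S ∧ S * S = adjoint T * T := by
  let := realInner D (H := H)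
  let AD : Op D H → (H →L[ℝ] H) := fun S => S.restrictScalars ℝ
  have hAD : ∀ S : Op D H, ContinuousLinearMap.adjoint (AD S) = AD (adjoint S) := by
    intro S
    symm
    rw [ContinuousLinearMap.eq_adjoint_iff]
    intro x y
    exact congrArg re (adjoint_inner_left S x y)
  have hinj : ∀ {S R : Op D H}, AD S = AD R → S = R := by
    intro S R h
    ext x
    exact congrArg (fun F : H →L[ℝ] H => F x) h
  have hmul : ∀ S R : Op D H, AD (S * R) = AD S * AD R := fun S R => rfl
  have hpos : ∀ S : Op D H, IsPositive S → ∀ x, 0 ≤ inner ℝ x (AD S x) := by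
    intro S hS x
    obtain ⟨r, hr, h⟩ := hS x
    change 0 ≤ re (inner D x (S x))
    rw [h, re_algebraMap]
    exact hr
  obtain ⟨S, hS, hS0, hSS, hSC⟩ := exists_real_abs (AD T)
  rw [hAD, ← hmul] at hSS hSC
  have hlin : ∀ (q : Dᵐᵒᵖ) (x : H), S (q • x) = q • S x := by
    intro q x
    let C : H →L[ℝ] H :=
      { toFun := fun x => q • x
        map_add' := smul_add q
        map_smul' := fun r x => (smul_comm r q x).symm
        cont := continuous_const_smul q }
    have hC : Commute C (AD (adjoint T * T)) := by
      ext y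
      exact ((adjoint T * T).map_smul q y).symm
    exact (congrArg (fun F : H →L[ℝ] H => F x) (hSC C hC).eq).symm
  let S' : Op D H := ⟨⟨⟨S, map_add S⟩, hlin⟩, S.continuous⟩
  have hS' : AD S' = S := rfl
  have hsa : adjoint S' = S' := hinj (by rw [← hAD, hS', hS])
  refine ⟨S', ⟨hsa, ?_, hinj (by rw [hmul, hS', hSS])⟩, ?_⟩
  · intro u
    refine ⟨re (inner D u (S' u)), hS0 u, ?_⟩
    have h : star (inner D u (S' u)) = inner D u (S' u) := by
      rw [star_rinner, ← adjoint_inner_left, hsa]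
    rw [algebraMap_re, h, ← two_smul ℝ, smul_smul]
    norm_num
  · rintro R ⟨hR, hR0, hRR⟩
    exact hinj (real_sqrt_unique hS hS0 hSS hSC (by rw [hAD, hR]) (hpos R hR0)
      (by rw [← hmul, hRR]))

/-- The absolute value `|T| = √(T^* T)`: the positive selfadjoint operator whose square
is `T^* T`. -/
noncomputable def absOp (T : Op D H) : Op D H := (existsUnique_abs T).choose

theorem absOp_spec (T : Op D H) :
    adjoint (absOp T) = absOp T ∧ IsPositive (absOp T) ∧ absOp T * absOp T = adjoint T * T :=
  (existsUnique_abs T).choose_spec.1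

/-! ### Hilbert bases and trace-class operators -/

variable (D) in
/-- `N ⊆ H` is a Hilbert basis: an orthonormal set whose orthogonal complement is zero. -/
def IsHilbertBasis (N : Set H) : Prop :=
  (∀ u ∈ N, inner D u u = 1) ∧ (∀ u ∈ N, ∀ v ∈ N, u ≠ v → inner D u v = 0) ∧
    ∀ x : H, (∀ u ∈ N, inner D u x = 0) → x = 0

/-- The real number `⟨u||T|u⟩`. -/
noncomputable def absDiag (T : Op D H) (u : H) : ℝ := re (inner D u (absOp T u))

variable (D H) in
/-- `𝔅₁(H)`: the operators with `∑_{u ∈ N} ⟨u||T|u⟩ < ∞` for some Hilbert basis `N`. -/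
def traceClass : Set (Op D H) :=
  {T | ∃ N : Set H, IsHilbertBasis D N ∧ Summable fun u : N => absDiag T u}

/-- The operator `Δ_q(T) = T² - T (q + q̄) + I |q|²`. -/
noncomputable def sphericalOp (T : Op D H) (q : D) : Op D H :=
  T * T - (2 * re q) • T + re (star q * q) • (1 : Op D H)

open Classical in
/-- The point spectrum `σ_p(T) ⊆ D`. For `D = ℝ, ℂ` it consists of the `q` for which `T - q I` is
not injective. For `D = ℍ` it is the spherical point spectrum: the `q` for which `Δ_q(T)` is not
injective. -/
noncomputable def pointSpectrum (T : Op D H) : Set D :=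
  if ∀ a b : D, a * b = b * a then {q | ∃ u : H, u ≠ 0 ∧ T u = op q • u}
  else {q | ¬ Function.Injective (sphericalOp T q)}

/-- The eigenspace of `T` for a real eigenvalue `s`. -/
noncomputable def eigenspace (T : Op D H) (s : ℝ) : Submodule Dᵐᵒᵖ H :=
  LinearMap.ker (T - s • (1 : Op D H)).toLinearMap

/-- The dimension `d_s` over `D` of the eigenspace, in `ℕ ∪ {∞}`. -/
noncomputable def eigenDim (T : Op D H) (s : ℝ) : ℕ∞ :=
  Cardinal.toENat (Module.rank Dᵐᵒᵖ (eigenspace T s))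

/-- `∑ s d_s` over the `s ∈ σ_p(|T|)`, as an element of `[0, ∞]`, where `0 · ∞ = 0`. -/
noncomputable def eTraceNorm (T : Op D H) : ℝ≥0∞ :=
  ∑' s : {s : ℝ // algebraMap ℝ D s ∈ pointSpectrum (absOp T)},
    ENNReal.ofReal s.1 * (eigenDim (absOp T) s.1 : ℝ≥0∞)

/-- `‖T‖₁ = ∑ s d_s`, as a real number; meaningful when the sum is finite. -/
noncomputable def traceNorm (T : Op D H) : ℝ := (eTraceNorm T).toReal

end Hilbert

/-- `V ⊆ E` is a `𝕜`-linear subspace which is a Banach space for the norm `ν`. -/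
structure IsBanachSpace (𝕜 : Type*) [NormedRing 𝕜] {E : Type*} [AddCommGroup E] [Module 𝕜 E]
    (V : Set E) (ν : E → ℝ) : Prop where
  zero_mem : 0 ∈ V
  add_mem : ∀ x ∈ V, ∀ y ∈ V, x + y ∈ V
  smul_mem : ∀ (c : 𝕜), ∀ x ∈ V, c • x ∈ V
  norm_nonneg : ∀ x ∈ V, 0 ≤ ν x
  norm_eq_zero : ∀ x ∈ V, ν x = 0 ↔ x = 0
  norm_add_le : ∀ x ∈ V, ∀ y ∈ V, ν (x + y) ≤ ν x + ν y
  norm_smul : ∀ (c : 𝕜), ∀ x ∈ V, ν (c • x) = ‖c‖ * ν x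
  complete : ∀ x : ℕ → E, (∀ n, x n ∈ V) →
    (∀ ε > 0, ∃ n₀, ∀ m ≥ n₀, ∀ n ≥ n₀, ν (x m - x n) < ε) →
    ∃ y ∈ V, ∀ ε > 0, ∃ n₀, ∀ n ≥ n₀, ν (x n - y) < ε

end RCH

/-! Put d = dim_ℝ D. With (x|y) = Re⟨x|y⟩ the space H becomes a real Hilbert space, and multiplying
the vectors of a Hilbert basis by a real orthonormal basis of D gives a real Hilbert basis. Because
⟨u||T|u⟩ is real, the real trace of |T| is d times the trace over D (`tsum_absDiag`). Real
dimensions of eigenspaces are also d times those over D (`eigenTrace_absOp`). The factor d cancels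
everywhere, so the work is done over ℝ.

A positive symmetric P satisfies ‖Px‖² ≤ ‖P‖(x|Px). If its trace is finite in one basis, then P is
Hilbert–Schmidt, hence compact. A compact symmetric P has an eigenbasis, and Tonelli with Parseval
carries the trace from there to any other basis. The trace is therefore ∑ μ dim ker(P - μ) in every
basis, which yields (a), (b) and (c).

Since |S + T| has no simple relation to |S| and |T|, parts (d) and (e) rest on duality. For compact
T, d‖T‖₁ ≤ c exactly when ∑ (eᵢ|T fᵢ) ≤ c for all finite Bessel families e, f (`trBound_iff`).
Expansion in an eigenbasis of |T| and Cauchy–Schwarz give one direction. Testing on eigenvectors b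
and their normalized images T b gives the other, and replaces the polar decomposition. Such bounds
visibly survive sums, adjoints, composition with bounded operators and pointwise limits. The
triangle inequality, the ideal property and completeness follow. Compactness is carried along
separately. -/

set_option linter.unusedSectionVars false

/-! ### Trace-class operators on a real Hilbert space -/

namespace RealTrace

section RealHilbert

open Module.End

universe u

variable {E : Type u} [NormedAddCommGroup E] [InnerProductSpace ℝ E]

/-! ### Finite Bessel families and the bounds tested on them. -/

/-- A finite family satisfying Bessel's inequality. -/
def IsBessel {ι : Type*} [Fintype ι] (e : ι → E) : Prop :=
  ∀ x, ∑ i, inner ℝ (e i) x ^ 2 ≤ ‖x‖ ^ 2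

theorem _root_.Orthonormal.isBessel {ι : Type*} [Fintype ι] {e : ι → E} (he : Orthonormal ℝ e) :
    IsBessel e := by
  intro x
  simpa using he.sum_inner_products_le x (s := Finset.univ)

theorem IsBessel.comp_equiv {ι κ : Type*} [Fintype ι] [Fintype κ] {e : ι → E} (he : IsBessel e)
    (σ : κ ≃ ι) : IsBessel (e ∘ σ) := by
  intro x
  have := Equiv.sum_comp σ fun i => inner ℝ (e i) x ^ 2
  simpa [this] using he x

/-- `∑ ⟨eᵢ|T fᵢ⟩ ≤ c` for all finite Bessel families `e` and `f`. -/
def TrBound (T : E →L[ℝ] E) (c : ℝ) : Prop :=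
  ∀ (n : ℕ) (e f : Fin n → E), IsBessel e → IsBessel f → ∑ i, inner ℝ (e i) (T (f i)) ≤ c

theorem TrBound.sum_le {T : E →L[ℝ] E} {c : ℝ} (h : TrBound T c) {ι : Type*} [Fintype ι]
    {e f : ι → E} (he : IsBessel e) (hf : IsBessel f) : ∑ i, inner ℝ (e i) (T (f i)) ≤ c := by
  have σ := (Fintype.equivFin ι).symm
  rw [← Equiv.sum_comp σ]
  exact h _ _ _ (he.comp_equiv σ) (hf.comp_equiv σ)

theorem TrBound.mono {T : E →L[ℝ] E} {c d : ℝ} (h : TrBound T c) (hcd : c ≤ d) : TrBound T d :=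
  fun n e f he hf => (h n e f he hf).trans hcd

theorem TrBound.nonneg {T : E →L[ℝ] E} {c : ℝ} (h : TrBound T c) : 0 ≤ c := by
  simpa using h 0 Fin.elim0 Fin.elim0 (fun x => by simp) (fun x => by simp)

theorem trBound_zero : TrBound (0 : E →L[ℝ] E) 0 := fun n e f _ _ => by simp

theorem TrBound.add {S T : E →L[ℝ] E} {c d : ℝ} (hS : TrBound S c) (hT : TrBound T d) :
    TrBound (S + T) (c + d) := by
  intro n e f he hf
  simp only [add_apply, inner_add_right, Finset.sum_add_distrib]
  exact add_le_add (hS n e f he hf) (hT n e f he hf)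

/-- Each inequality involves only finitely many vectors, so pointwise convergence is enough.
Completeness of the trace norm rests on this. -/
theorem TrBound.of_tendsto {S : ℕ → E →L[ℝ] E} {T : E →L[ℝ] E} {c : ℝ}
    (hS : ∀ᶠ m in Filter.atTop, TrBound (S m) c)
    (hT : ∀ x, Filter.Tendsto (fun m => S m x) Filter.atTop (nhds (T x))) : TrBound T c := by
  intro n e f he hf
  refine le_of_tendsto (tendsto_finsetSum Finset.univ fun i _ =>
    (tendsto_const_nhds (x := e i)).inner (hT (f i))) ?_
  filter_upwards [hS] with m hm using hm n e f he hf

theorem TrBound.adjoint [CompleteSpace E] {T : E →L[ℝ] E} {c : ℝ} (h : TrBound T c) :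
    TrBound (ContinuousLinearMap.adjoint T) c := by
  intro n e f he hf
  refine le_of_eq_of_le (Finset.sum_congr rfl fun i _ => ?_) (h n f e hf he)
  rw [ContinuousLinearMap.adjoint_inner_right, real_inner_comm]

/-- Move B to the other side: the vectors ‖B‖⁻¹ B* eᵢ again satisfy Bessel's inequality, though they
need not be orthonormal when the eᵢ are. This is why the test families are Bessel and not
orthonormal. -/
theorem TrBound.comp_left [CompleteSpace E] {T : E →L[ℝ] E} {c : ℝ} (h : TrBound T c) (B : E →L[ℝ] E) :
    TrBound (B * T) (‖B‖ * c) := by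
  intro n e f he hf
  rcases eq_or_ne B 0 with rfl | hB
  · simp
  have hB0 : 0 < ‖B‖ := norm_pos_iff.2 hB
  have he' : IsBessel fun i => ‖B‖⁻¹ • ContinuousLinearMap.adjoint B (e i) := by
    intro x
    have h1 := he (B x)
    have h2 : ‖B x‖ ^ 2 ≤ ‖B‖ ^ 2 * ‖x‖ ^ 2 := by
      rw [← mul_pow]; exact pow_le_pow_left₀ (norm_nonneg _) (B.le_opNorm x) 2
    simp only [real_inner_smul_left, mul_pow, ← Finset.mul_sum, inv_pow,
      ContinuousLinearMap.adjoint_inner_left]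
    rw [inv_mul_le_iff₀ (by positivity)]
    exact h1.trans h2
  have h3 := h n _ f he' hf
  simp only [real_inner_smul_left, ← Finset.mul_sum,
    ContinuousLinearMap.adjoint_inner_left] at h3
  rwa [inv_mul_le_iff₀ hB0] at h3

theorem TrBound.comp_right [CompleteSpace E] {T : E →L[ℝ] E} {c : ℝ} (h : TrBound T c) (B : E →L[ℝ] E) :
    TrBound (T * B) (c * ‖B‖) := by
  have := (h.adjoint.comp_left (ContinuousLinearMap.adjoint B)).adjoint
  rw [LinearIsometryEquiv.norm_map, mul_comm] at this
  convert! this using 1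
  change _ = ContinuousLinearMap.adjoint (_ ∘L _)
  rw [ContinuousLinearMap.adjoint_comp, ContinuousLinearMap.adjoint_adjoint,
    ContinuousLinearMap.adjoint_adjoint]
  rfl

/-! #### The eigenbasis of a compact symmetric operator -/

/-- Spectral theorem: Hilbert bases of the single eigenspaces together form one of E. Indexing by
pairs keeps the eigenvalue visible as `i.1`, so that multiplicities can be counted. -/
theorem exists_eigenbasis [CompleteSpace E] {P : E →L[ℝ] E} (hP : IsCompactOperator P)
    (hs : P.toLinearMap.IsSymmetric) :
    ∃ (ι : ℝ → Type u) (c : ∀ μ, HilbertBasis (ι μ) ℝ (eigenspace P.toLinearMap μ))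
      (b : HilbertBasis (Σ μ, ι μ) ℝ E), ∀ i, b i = c i.1 i.2 := by
  have hcl : ∀ μ, IsClosed (eigenspace P.toLinearMap μ : Set E) := by
    intro μ
    have : (eigenspace P.toLinearMap μ : Set E) = {x | P x = μ • x} := by
      ext x; simp
    rw [this]
    exact isClosed_eq P.continuous (continuous_const_smul μ)
  have hcomp : ∀ μ, CompleteSpace (eigenspace P.toLinearMap μ) := fun μ =>
    (hcl μ).completeSpace_coe
  choose w c hc using fun μ => exists_hilbertBasis ℝ (eigenspace P.toLinearMap μ)
  have ho : Orthonormal ℝ fun i : Σ μ, w μ => ((c i.1 i.2 : eigenspace P.toLinearMap i.1) : E) :=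
    hs.orthogonalFamily_eigenspaces.orthonormal_sigma_orthonormal fun μ => (c μ).orthonormal
  have hbot : (Submodule.span ℝ (Set.range fun i : Σ μ, w μ =>
      ((c i.1 i.2 : eigenspace P.toLinearMap i.1) : E)))ᗮ = ⊥ := by
    rw [← P.orthogonalComplement_iSup_eigenspaces_eq_bot hP hs, eq_comm]
    refine le_antisymm (Submodule.orthogonal_le ?_) ?_
    · rw [Submodule.span_le]
      rintro _ ⟨i, rfl⟩
      exact Submodule.mem_iSup_of_mem i.1 (c i.1 i.2).2
    · rw [← Submodule.iInf_orthogonal, le_iInf_iff]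
      intro μ x hx v hv
      -- A vector orthogonal to the basis of one eigenspace is orthogonal to all of it, by
      -- continuity of the scalar product along the expansion of `v`.
      have h := (((c μ).hasSum_repr ⟨v, hv⟩).mapL (Submodule.subtypeL _)).mapL (innerSL ℝ x)
      have h0 : ∀ i, inner ℝ x ((c μ i : eigenspace P.toLinearMap μ) : E) = 0 := fun i => by
        rw [real_inner_comm]
        exact hx _ (Submodule.subset_span ⟨⟨μ, i⟩, rfl⟩)
      simp only [map_smul, Submodule.subtypeL_apply, innerSL_apply_apply, h0, smul_zero] at h
      rw [real_inner_comm]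
      exact h.unique hasSum_zero
  exact ⟨fun μ => w μ, c, HilbertBasis.mkOfOrthogonalEqBot ho hbot, fun i => by
    rw [HilbertBasis.coe_mkOfOrthogonalEqBot]⟩

theorem tsum_eigenbasis [CompleteSpace E] {P : E →L[ℝ] E} (hP : IsCompactOperator P) {ι : ℝ → Type u}
    (c : ∀ μ, HilbertBasis (ι μ) ℝ (eigenspace P.toLinearMap μ)) :
    ∑' i : Σ μ, ι μ, ENNReal.ofReal i.1 = ∑' μ : ℝ, ENNReal.ofReal μ *
      ((Cardinal.toENat (Module.rank ℝ (eigenspace P.toLinearMap μ)) : ℕ∞) : ℝ≥0∞) := by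
  rw [ENNReal.tsum_sigma']
  refine tsum_congr fun μ => ?_
  -- For μ ≤ 0 the weight `ENNReal.ofReal μ` is 0, which also settles an infinite-dimensional
  -- kernel; for μ > 0 compactness makes the eigenspace finite-dimensional.
  rcases le_or_gt μ 0 with h | h
  · simp [ENNReal.ofReal_of_nonpos h]
  have := P.finite_dimensional_eigenspace hP μ h.ne'
  have := (c μ).orthonormal.linearIndependent.finite
  have := Fintype.ofFinite (ι μ)
  rw [rank_eq_card_basis (c μ).toOrthonormalBasis.toBasis]
  simp [mul_comm]

/-! ### Independence of the trace from the basis. -/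

variable {ι κ : Type*}

theorem tsum_inner_sq (b : HilbertBasis ι ℝ E) (x : E) :
    ∑' i, ENNReal.ofReal (inner ℝ (b i) x ^ 2) = ENNReal.ofReal (‖x‖ ^ 2) := by
  have h := b.hasSum_inner_mul_inner x x
  have e : (fun i => inner ℝ x (b i) * inner ℝ (b i) x) = fun i => inner ℝ (b i) x ^ 2 := by
    ext i; rw [real_inner_comm, sq]
  rw [e, real_inner_self_eq_norm_sq] at h
  rw [← ENNReal.ofReal_tsum_of_nonneg (fun i => sq_nonneg _) h.summable, h.tsum_eq]

/-- The trace of an operator diagonal in the basis `b` is the sum of the eigenvalues in every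
basis `b'`. -/
theorem tsum_diag_eq {P : E →L[ℝ] E} (hs : P.toLinearMap.IsSymmetric) (b : HilbertBasis ι ℝ E)
    {s : ι → ℝ} (hs0 : ∀ i, 0 ≤ s i) (hb : ∀ i, P (b i) = s i • b i) (b' : HilbertBasis κ ℝ E) :
    ∑' i, ENNReal.ofReal (inner ℝ (b' i) (P (b' i))) = ∑' j, ENNReal.ofReal (s j) := by
  have h1 : ∀ i, ENNReal.ofReal (inner ℝ (b' i) (P (b' i)))
      = ∑' j, ENNReal.ofReal (s j) * ENNReal.ofReal (inner ℝ (b' i) (b j) ^ 2) := by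
    intro i
    have h := b.hasSum_inner_mul_inner (b' i) (P (b' i))
    have e : (fun j => inner ℝ (b' i) (b j) * inner ℝ (b j) (P (b' i)))
        = fun j => s j * inner ℝ (b' i) (b j) ^ 2 := by
      ext j
      have := hs (b j) (b' i)
      simp only [ContinuousLinearMap.coe_coe] at this
      rw [← this, hb, real_inner_smul_left, real_inner_comm (b' i) (b j)]
      ring
    rw [e] at h
    rw [← h.tsum_eq, ENNReal.ofReal_tsum_of_nonneg
      (fun j => mul_nonneg (hs0 j) (sq_nonneg _)) h.summable]
    exact tsum_congr fun j => ENNReal.ofReal_mul (hs0 j)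
  simp only [h1]
  -- Tonelli in [0, ∞]; afterwards the sum over the basis `b'` is ‖b j‖² = 1 by Parseval.
  rw [ENNReal.tsum_comm]
  refine tsum_congr fun j => ?_
  rw [ENNReal.tsum_mul_left, tsum_inner_sq, b.orthonormal.1 j]
  simp

/-! #### Compactness -/

/-- Expand positivity at x - t P x and bound (Px|P Px) by ‖P‖‖Px‖². The choice t = ‖P‖⁻¹ minimizes
the resulting quadratic in t. -/
theorem norm_sq_le_of_nonneg {P : E →L[ℝ] E} (hs : P.toLinearMap.IsSymmetric)
    (hp : ∀ x, 0 ≤ inner ℝ x (P x)) (x : E) : ‖P x‖ ^ 2 ≤ ‖P‖ * inner ℝ x (P x) := by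
  rcases eq_or_ne P 0 with rfl | hP
  · simp
  have hP0 : 0 < ‖P‖ := norm_pos_iff.2 hP
  have h := hp (x - ‖P‖⁻¹ • P x)
  have e : inner ℝ x (P (P x)) = ‖P x‖ ^ 2 := by
    rw [← real_inner_self_eq_norm_sq]; exact (hs x (P x)).symm
  have e2 : inner ℝ (P x) (P (P x)) ≤ ‖P‖ * ‖P x‖ ^ 2 := by
    refine (real_inner_le_norm _ _).trans ?_
    have := mul_le_mul_of_nonneg_left (P.le_opNorm (P x)) (norm_nonneg (P x))
    linarith
  simp only [map_sub, map_smul, inner_sub_left, inner_sub_right, real_inner_smul_left,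
    real_inner_smul_right, e, real_inner_self_eq_norm_sq] at h
  have h2 := mul_le_mul_of_nonneg_left e2 (by positivity : 0 ≤ ‖P‖⁻¹ * ‖P‖⁻¹)
  have h3 : ‖P‖⁻¹ * ‖P‖⁻¹ * (‖P‖ * ‖P x‖ ^ 2) = ‖P‖⁻¹ * ‖P x‖ ^ 2 := by field_simp
  rw [← inv_mul_le_iff₀ hP0]
  linarith

/-- P is the norm limit of finite sums of the rank-one operators x ↦ (bᵢ|x) P bᵢ: Cauchy–Schwarz and
Bessel bound the norm of such a sum by √(∑ ‖P bᵢ‖²). -/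
theorem isCompactOperator_of_hilbertSchmidt [CompleteSpace E] {P : E →L[ℝ] E} (b : HilbertBasis ι ℝ E)
    (h : Summable fun i => ‖P (b i)‖ ^ 2) : IsCompactOperator P := by
  let A : ι → E →L[ℝ] E := fun i => (innerSL ℝ (b i)).smulRight (P (b i))
  have hA : ∀ i, IsCompactOperator (A i) := by
    intro i
    have : A i = (ContinuousLinearMap.toSpanSingleton ℝ (P (b i))) ∘L innerSL ℝ (b i) := by
      ext x; simp [A]
    rw [this]
    exact (isCompactOperator_of_locallyCompactSpace_dom (innerSL ℝ (b i))).clm_comp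
      (ContinuousLinearMap.toSpanSingleton ℝ (P (b i)))
  have hbound : ∀ t : Finset ι, ‖∑ i ∈ t, A i‖ ≤ √(∑ i ∈ t, ‖P (b i)‖ ^ 2) := by
    intro t
    refine ContinuousLinearMap.opNorm_le_bound _ (Real.sqrt_nonneg _) fun x => ?_
    rw [sum_apply]
    have h1 : ∑ i ∈ t, |inner ℝ (b i) x| ^ 2 ≤ ‖x‖ ^ 2 := by
      simpa using b.orthonormal.sum_inner_products_le x (s := t)
    calc ‖∑ i ∈ t, A i x‖ ≤ ∑ i ∈ t, ‖P (b i)‖ * |inner ℝ (b i) x| := by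
          refine (norm_sum_le _ _).trans (le_of_eq (Finset.sum_congr rfl fun i _ => ?_))
          simp [A, norm_smul, mul_comm]
      _ ≤ √(∑ i ∈ t, ‖P (b i)‖ ^ 2) * √(∑ i ∈ t, |inner ℝ (b i) x| ^ 2) :=
          Real.sum_mul_le_sqrt_mul_sqrt _ _ _
      _ ≤ _ := by
          gcongr
          exact Real.sqrt_le_iff.2 ⟨norm_nonneg _, h1⟩
  have hsum : Summable A := by
    rw [summable_iff_vanishing_norm]
    intro ε hε
    obtain ⟨s, hs⟩ := summable_iff_vanishing_norm.1 h (ε ^ 2) (by positivity)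
    refine ⟨s, fun t ht => (hbound t).trans_lt ?_⟩
    rw [Real.sqrt_lt' hε]
    exact (le_abs_self _).trans_lt (hs t ht)
  have hP : ∑' i, A i = P := by
    ext x
    have h1 : HasSum (fun i => A i x) ((∑' i, A i) x) :=
      hsum.hasSum.mapL (ContinuousLinearMap.apply ℝ E x)
    have h2 : HasSum (fun i => A i x) (P x) := by
      have := (b.hasSum_repr x).mapL P
      simpa [A, b.repr_apply_apply] using this
    exact h1.unique h2
  have hlim := hsum.hasSum
  rw [hP] at hlim
  refine isClosed_setOfPred_isCompactOperator.mem_of_tendsto hlim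
    (Filter.Eventually.of_forall fun t => ?_)
  exact sum_mem (S := compactOperator (RingHom.id ℝ) E E) (fun i _ => hA i)

theorem isCompactOperator_of_trace [CompleteSpace E] {P : E →L[ℝ] E} (hs : P.toLinearMap.IsSymmetric)
    (hp : ∀ x, 0 ≤ inner ℝ x (P x)) (b : HilbertBasis ι ℝ E)
    (h : ∑' i, ENNReal.ofReal (inner ℝ (b i) (P (b i))) ≠ ⊤) : IsCompactOperator P := by
  refine isCompactOperator_of_hilbertSchmidt b ?_
  have h1 : Summable fun i => inner ℝ (b i) (P (b i)) := by
    refine (ENNReal.summable_toReal h).congr fun i => ?_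
    rw [ENNReal.toReal_ofReal (hp _)]
  exact Summable.of_nonneg_of_le (fun i => sq_nonneg _)
    (fun i => norm_sq_le_of_nonneg hs hp (b i)) (h1.mul_left ‖P‖)

/-- A finite net for the T-image of the unit ball yields one for the S-image. This carries
compactness between T, T* and |T| through products such as T*T. -/
theorem isCompactOperator_of_norm_sq_le [CompleteSpace E] {S T : E →L[ℝ] E}
    (hT : IsCompactOperator T) (h : ∀ x, ‖S x‖ ^ 2 ≤ ‖x‖ * ‖T x‖) : IsCompactOperator S := by
  have h1 : TotallyBounded (T '' Metric.closedBall 0 1) :=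
    (((isCompactOperator_iff_isCompact_closure_image_closedBall (T : E →ₗ[ℝ] E)
      zero_lt_one).1 hT).totallyBounded).subset subset_closure
  refine (isCompactOperator_iff_isCompact_closure_image_closedBall (S : E →ₗ[ℝ] E)
    zero_lt_one).2 ?_
  refine TotallyBounded.isCompact_of_isClosed (TotallyBounded.closure ?_) isClosed_closure
  rw [Metric.totallyBounded_iff] at *
  intro ε hε
  -- The centres are chosen inside the image, so they lift to points of the unit ball. Points of
  -- that ball are at distance at most 2, hence ‖S(x - y)‖² ≤ 2‖T(x - y)‖ < ε² for the radius ε²/2.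
  obtain ⟨t, hts, ht, hcov⟩ := Metric.finite_approx_of_totallyBounded
    (Metric.totallyBounded_iff.2 h1) (ε ^ 2 / 2) (by positivity)
  obtain ⟨u, hu, hut, rfl⟩ := Set.exists_subset_image_finite_and.1 ⟨t, hts, ht, rfl⟩
  refine ⟨S '' u, hut.image _, ?_⟩
  rintro _ ⟨x, hx, rfl⟩
  have := hcov (Set.mem_image_of_mem T hx)
  simp only [Set.mem_iUnion, Set.mem_image, exists_prop, exists_exists_and_eq_and,
    Metric.mem_ball, dist_eq_norm, ← map_sub] at this ⊢
  obtain ⟨y, hy, hxy⟩ := this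
  refine ⟨y, hy, ?_⟩
  have h2 : ‖x - y‖ ≤ 2 := by
    have hx1 := mem_closedBall_zero_iff.1 hx
    have hy1 := mem_closedBall_zero_iff.1 (hu hy)
    exact (norm_sub_le _ _).trans (by linarith)
  have h3 := (h (x - y)).trans (mul_le_mul_of_nonneg_right h2 (norm_nonneg _))
  change ‖S x - S y‖ < ε
  rw [← map_sub]
  refine lt_of_pow_lt_pow_left₀ 2 hε.le ?_
  linarith

/-! #### The variational characterization of the trace norm -/

/-- Expand each fᵢ in `b`. For fixed j, Cauchy–Schwarz over i and the two Bessel inequalities bound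
the j-th contribution by ‖b j‖ ‖T (b j)‖ = s j. -/
theorem trBound_of_eigenbasis {T : E →L[ℝ] E} (b : HilbertBasis ι ℝ E) {s : ι → ℝ}
    (hs0 : ∀ i, 0 ≤ s i) (hb : ∀ i, ‖T (b i)‖ = s i) {c : ℝ} (hc0 : 0 ≤ c)
    (hc : ∑' j, ENNReal.ofReal (s j) ≤ ENNReal.ofReal c) : TrBound T c := by
  intro n e f he hf
  have hsum : Summable s := by
    refine (ENNReal.summable_toReal (ne_top_of_le_ne_top ENNReal.ofReal_ne_top hc)).congr
      fun i => ENNReal.toReal_ofReal (hs0 i)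
  have hsc : ∑' j, s j ≤ c := by
    rwa [← ENNReal.ofReal_tsum_of_nonneg hs0 hsum, ENNReal.ofReal_le_ofReal_iff hc0] at hc
  have h1 : HasSum (fun j => ∑ i, inner ℝ (b j) (f i) * inner ℝ (e i) (T (b j)))
      (∑ i, inner ℝ (e i) (T (f i))) := by
    refine hasSum_sum fun i _ => ?_
    have := ((b.hasSum_repr (f i)).mapL T).mapL (innerSL ℝ (e i))
    simpa [b.repr_apply_apply, real_inner_smul_right] using this
  refine (hasSum_le (fun j => ?_) h1 hsum.hasSum).trans hsc
  refine (Real.sum_mul_le_sqrt_mul_sqrt _ _ _).trans ?_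
  have h2 : √(∑ i, inner ℝ (b j) (f i) ^ 2) ≤ 1 := by
    rw [Real.sqrt_le_one]
    have := hf (b j)
    rw [b.orthonormal.1 j] at this
    simpa [real_inner_comm] using this
  have h3 : √(∑ i, inner ℝ (e i) (T (b j)) ^ 2) ≤ s j := by
    rw [← hb]
    exact Real.sqrt_le_iff.2 ⟨norm_nonneg _, he _⟩
  calc _ ≤ 1 * s j := mul_le_mul h2 h3 (Real.sqrt_nonneg _) zero_le_one
    _ = s j := one_mul _

/-- Test the bound on fⱼ = b j and eⱼ = T (b j) / s j, over the j with s j > 0. The hypothesis on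
scalar products makes the eⱼ orthonormal; they are the images of the b j under the partial isometry
of the polar decomposition, which is thus not needed. -/
theorem TrBound.tsum_le {T : E →L[ℝ] E} {c : ℝ} (h : TrBound T c) (b : HilbertBasis ι ℝ E)
    {s : ι → ℝ} (hb : ∀ i j, inner ℝ (T (b i)) (T (b j)) = s j ^ 2 * inner ℝ (b i) (b j)) :
    ∑' j, ENNReal.ofReal (s j) ≤ ENNReal.ofReal c := by
  classical
  have hn : ∀ i, inner ℝ (T (b i)) (T (b i)) = s i ^ 2 := by
    intro i
    rw [hb, real_inner_self_eq_norm_sq, b.orthonormal.1 i]; simp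
  have hsupp : Function.support (fun j => ENNReal.ofReal (s j)) ⊆ {j | 0 < s j} := by
    intro j hj
    simpa using hj
  rw [← tsum_subtype_eq_of_support_subset hsupp, ENNReal.tsum_eq_iSup_sum]
  refine iSup_le fun F => ?_
  have he : Orthonormal ℝ fun j : {j | 0 < s j} => (s j)⁻¹ • T (b j) := by
    rw [orthonormal_iff_ite]
    rintro ⟨i, hi⟩ ⟨j, hj⟩
    rw [real_inner_smul_left, real_inner_smul_right, hb, orthonormal_iff_ite.1 b.orthonormal i j]
    have hj' : s j ≠ 0 := (Set.mem_ofPred.1 hj).ne'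
    rcases eq_or_ne i j with rfl | hij
    · simp; field_simp
    · simp [hij]
  have hf : Orthonormal ℝ fun j : {j | 0 < s j} => b j :=
    b.orthonormal.comp _ Subtype.val_injective
  have h1 := h.sum_le (he.comp (Subtype.val : F → _) Subtype.val_injective).isBessel
    (hf.comp (Subtype.val : F → _) Subtype.val_injective).isBessel
  have h2 : ∀ j : F, inner ℝ ((s j)⁻¹ • T (b j)) (T (b j)) = s j := by
    intro j
    have hj : s j ≠ 0 := (Set.mem_ofPred.1 j.1.2).ne'
    rw [real_inner_smul_left, hn]
    field_simp
  simp only [Function.comp_apply, h2] at h1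
  rw [← ENNReal.ofReal_sum_of_nonneg fun j _ => (Set.mem_ofPred.1 j.2).le]
  refine ENNReal.ofReal_le_ofReal ?_
  rwa [Finset.sum_coe_sort F fun j => s j] at h1

/-- `∑ μ dim ker (P - μ)` over the real numbers `μ ≥ 0`. -/
noncomputable def eigenTrace (P : E →L[ℝ] E) : ℝ≥0∞ :=
  ∑' μ : ℝ, ENNReal.ofReal μ *
    ((Cardinal.toENat (Module.rank ℝ (eigenspace P.toLinearMap μ)) : ℕ∞) : ℝ≥0∞)

/-- T enters only through (Tx|Ty) = (Px|Py): T maps an eigenbasis of P to orthogonal vectors whose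
lengths are the eigenvalues. -/
theorem eigenTrace_spec [CompleteSpace E] {P : E →L[ℝ] E} (hP : IsCompactOperator P)
    (hs : P.toLinearMap.IsSymmetric) (hp : ∀ x, 0 ≤ inner ℝ x (P x)) :
    (∀ {κ : Type u} (b : HilbertBasis κ ℝ E),
      ∑' i, ENNReal.ofReal (inner ℝ (b i) (P (b i))) = eigenTrace P) ∧
    ∀ T : E →L[ℝ] E, (∀ x y, inner ℝ (T x) (T y) = inner ℝ (P x) (P y)) → ∀ c, 0 ≤ c →
      (TrBound T c ↔ eigenTrace P ≤ ENNReal.ofReal c) := by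
  obtain ⟨ι, c, b, hb⟩ := exists_eigenbasis hP hs
  have hPb : ∀ i, P (b i) = i.1 • b i := fun i => by
    rw [hb]
    exact mem_eigenspace_iff.1 (c i.1 i.2).2
  have hs0 : ∀ i : Σ μ, ι μ, 0 ≤ i.1 := fun i => by
    have := hp (b i)
    rwa [hPb, real_inner_smul_right, real_inner_self_eq_norm_sq, b.orthonormal.1 i, one_pow,
      mul_one] at this
  have hsum := tsum_eigenbasis hP c
  refine ⟨fun b' => (tsum_diag_eq hs b hs0 hPb b').trans hsum, fun T hT d hd => ?_⟩
  have hTb : ∀ i j, inner ℝ (T (b i)) (T (b j)) = j.1 ^ 2 * inner ℝ (b i) (b j) := by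
    classical
    intro i j
    rw [hT, hPb, hPb, real_inner_smul_left, real_inner_smul_right,
      orthonormal_iff_ite.1 b.orthonormal i j]
    split_ifs with h
    · rw [h]; ring
    · ring
  refine ⟨fun h => hsum.symm.trans_le (h.tsum_le b hTb), fun h => ?_⟩
  refine trBound_of_eigenbasis b hs0 (fun i => ?_) hd (hsum.trans_le h)
  rw [← sq_eq_sq₀ (norm_nonneg _) (hs0 i), ← real_inner_self_eq_norm_sq, hTb,
    real_inner_self_eq_norm_sq, b.orthonormal.1 i]
  simp

end RealHilbert

end RealTrace

/-! ### Trace-class operators on a Hilbert space over `ℝ`, `ℂ` or `ℍ` -/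

namespace RCH

/-! ### A real orthonormal basis of the scalars. -/

section ScalarBasis

variable (D : Type*) [DivisionRing D] [StarRing D] [Algebra ℝ D] [IsScalar D]

theorem finiteDimensional_scalar : FiniteDimensional ℝ D := by
  rcases IsScalar.iso (D := D) with ⟨⟨e⟩⟩ | ⟨⟨e⟩⟩ | ⟨⟨e⟩⟩
  · exact e.toAlgEquiv.toLinearEquiv.symm.finiteDimensional
  · exact e.toAlgEquiv.toLinearEquiv.symm.finiteDimensional
  · exact e.toAlgEquiv.toLinearEquiv.symm.finiteDimensional

/-- The real inner product `(a|b) = Re (a̅ b)` on the scalars. -/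
@[reducible] noncomputable def scalarCore : InnerProductSpace.Core ℝ D where
  inner a b := re (star a * b)
  conj_inner_symm a b := by
    change re (star b * a) = re (star a * b)
    rw [← re_star, star_mul, star_star]
  re_inner_nonneg a := by
    obtain ⟨r, hr, h⟩ := exists_star_mul_self a
    change 0 ≤ re (star a * a)
    rwa [h, re_algebraMap]
  add_left a b c := by
    change re (star (a + b) * c) = re (star a * c) + re (star b * c)
    rw [star_add, add_mul, re_add]
  smul_left a b r := by
    change re (star (r • a) * b) = r * re (star a * b)
    rw [star_real_smul, smul_mul_assoc, re_smul]
  definite a h := by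
    change re (star a * a) = 0 at h
    obtain ⟨r, hr, h'⟩ := exists_star_mul_self a
    rw [h', re_algebraMap] at h
    rw [h, map_zero] at h'
    rcases mul_eq_zero.1 h' with h2 | h2
    · simpa using h2
    · exact h2

/-- The second clause is Parseval. The norm put on `D` lives only inside this proof; what leaves it
are identities for `re`. -/
theorem exists_scalarBasis : ∃ e : Fin (Module.finrank ℝ D) → D,
    (∀ i j, re (star (e i) * e j) = if i = j then 1 else 0) ∧
    ∀ q, ∑ j, re (star (e j) * q) ^ 2 = re (star q * q) := by
  let _ : NormedAddCommGroup D := (scalarCore D).toNormedAddCommGroup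
  let _ : InnerProductSpace ℝ D := InnerProductSpace.ofCore (scalarCore D).toCore
  have := finiteDimensional_scalar D
  let b := stdOrthonormalBasis ℝ D
  refine ⟨b, fun i j => orthonormal_iff_ite.1 b.orthonormal i j, fun q => ?_⟩
  have h := b.sum_sq_norm_inner_right q
  rw [← real_inner_self_eq_norm_sq] at h
  refine Eq.trans (Finset.sum_congr rfl fun j _ => ?_) h
  rw [Real.norm_eq_abs, sq_abs]
  rfl

/-- A real orthonormal basis of the scalars. -/
noncomputable def scalarBasis : Fin (Module.finrank ℝ D) → D := (exists_scalarBasis D).choose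

theorem re_star_scalarBasis_mul (i j : Fin (Module.finrank ℝ D)) :
    re (star (scalarBasis D i) * scalarBasis D j) = if i = j then 1 else 0 :=
  (exists_scalarBasis D).choose_spec.1 i j

variable {D} in
theorem sum_re_scalarBasis_sq (q : D) :
    ∑ j, re (star (scalarBasis D j) * q) ^ 2 = re (star q * q) :=
  (exists_scalarBasis D).choose_spec.2 q

theorem finrank_scalar_pos : 0 < Module.finrank ℝ D := by
  have := finiteDimensional_scalar D
  exact Module.finrank_pos

end ScalarBasis

section Hilbert

universe u v

variable {D : Type u} [DivisionRing D] [StarRing D] [Algebra ℝ D]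
variable {H : Type v} [NormedAddCommGroup H] [NormedSpace ℝ H] [Module Dᵐᵒᵖ H]
  [RightInnerProductSpace D H]

open RightInnerProductSpace

theorem rinner_smul_smul (x y : H) (p q : D) :
    inner D (op p • x) (op q • y) = star p * inner D x y * q := by
  rw [rinner_smul, rinner_smul_left]

theorem rinner_real_smul (x y : H) (r : ℝ) : inner D x (r • y) = r • inner D x y := by
  rw [real_smul_eq (D := D), rinner_smul, ← Algebra.commutes, Algebra.smul_def]

theorem mem_eigenspace {T : Op D H} {s : ℝ} {u : H} : u ∈ eigenspace T s ↔ T u = s • u := by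
  change T u - s • u = 0 ↔ _
  rw [sub_eq_zero]

/-! #### Hilbert bases -/

variable (D) in
-- Zorn: a nonzero vector orthogonal to a maximal orthonormal set could be normalized and adjoined.
-- Needed in (b), where a basis has to be produced.
theorem exists_isHilbertBasis (H : Type v) [NormedAddCommGroup H] [NormedSpace ℝ H]
    [Module Dᵐᵒᵖ H] [RightInnerProductSpace D H] : ∃ N : Set H, IsHilbertBasis D N := by
  let C : Set (Set H) := {N | (∀ u ∈ N, inner D u u = 1) ∧
    ∀ u ∈ N, ∀ v ∈ N, u ≠ v → inner D u v = 0}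
  obtain ⟨N, hN⟩ : ∃ N, Maximal (· ∈ C) N := by
    refine zorn_subset C fun c hc hch => ⟨⋃₀ c, ⟨?_, ?_⟩, fun s hs => Set.subset_sUnion_of_mem hs⟩
    · rintro u ⟨s, hs, hu⟩
      exact (hc hs).1 u hu
    · rintro u ⟨s, hs, hu⟩ v ⟨t, ht, hv⟩ huv
      rcases hch.total hs ht with h | h
      · exact (hc ht).2 u (h hu) v hv huv
      · exact (hc hs).2 u hu v (h hv) huv
  refine ⟨N, hN.prop.1, hN.prop.2, fun x hx => ?_⟩
  by_contra hx0
  let y : H := ‖x‖⁻¹ • x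
  have hy0 : ∀ u ∈ N, inner D u y = 0 := fun u hu => by
    change inner D u (‖x‖⁻¹ • x) = 0
    rw [real_smul_eq (D := D), rinner_smul, hx u hu, zero_mul]
  have hy1 : inner D y y = 1 := by
    rw [rinner_self, norm_smul, norm_inv, norm_norm,
      inv_mul_cancel₀ (norm_ne_zero_iff.2 hx0), one_pow, map_one]
  have hins : insert y N ∈ C := by
    refine ⟨?_, ?_⟩
    · rintro u (rfl | hu)
      · exact hy1
      · exact hN.prop.1 u hu
    · rintro u (rfl | hu) v (rfl | hv) huv
      · exact absurd rfl huv
      · rw [← star_rinner, hy0 v hv, star_zero]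
      · exact hy0 u hu
      · exact hN.prop.2 u hu v hv huv
  have hyN : y ∈ N := hN.le_of_ge hins (Set.subset_insert y N) (Set.mem_insert y N)
  have := hy0 y hyN
  rw [hy1] at this
  exact one_ne_zero this

variable [IsScalar D]

theorem re_rinner_self (x : H) : re (inner D x x) = ‖x‖ ^ 2 := by
  rw [rinner_self, re_algebraMap]

/-- A real scalar product is central in `D`, so it factors out of star eᵢ · r · eⱼ. Reality is what
lets every basis scalar contribute the same amount. -/
theorem re_rinner_scalarBasis {x y : H} {r : ℝ} (h : inner D x y = algebraMap ℝ D r)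
    (i j : Fin (Module.finrank ℝ D)) :
    re (inner D (op (scalarBasis D i) • x) (op (scalarBasis D j) • y))
      = r * if i = j then 1 else 0 := by
  rw [rinner_smul_smul, h, ← Algebra.commutes, mul_assoc, ← Algebra.smul_def, re_smul,
    re_star_scalarBasis_mul]

variable [CompleteSpace H]

/-- The products of a Hilbert basis with a real orthonormal basis of the scalars form a Hilbert
basis of the underlying real Hilbert space. -/
theorem IsHilbertBasis.exists_real {N : Set H} (hN : IsHilbertBasis D N) :
    letI := realInner D (H := H)
    ∃ b : HilbertBasis (N × Fin (Module.finrank ℝ D)) ℝ H,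
      ∀ p, b p = op (scalarBasis D p.2) • (p.1 : H) := by
  classical
  let := realInner D (H := H)
  let v : N × Fin (Module.finrank ℝ D) → H := fun p => op (scalarBasis D p.2) • (p.1 : H)
  have ho : Orthonormal ℝ v := by
    rw [orthonormal_iff_ite]
    rintro ⟨u, i⟩ ⟨w, j⟩
    change re (inner D (op (scalarBasis D i) • (u : H)) (op (scalarBasis D j) • (w : H))) = _
    rcases eq_or_ne u w with rfl | huw
    · rw [re_rinner_scalarBasis (r := 1) (by rw [hN.1 u u.2, map_one])]
      simp
    · rw [re_rinner_scalarBasis (r := 0) (by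
        rw [hN.2.1 u u.2 w w.2 (Subtype.coe_ne_coe.2 huw), map_zero])]
      simp [huw]
  have hbot : (Submodule.span ℝ (Set.range v))ᗮ = ⊥ := by
    rw [eq_bot_iff]
    intro x hx
    refine hN.2.2 x fun u hu => ?_
    have h0 : ∀ j, re (star (scalarBasis D j) * inner D u x) = 0 := fun j => by
      rw [← rinner_smul_left]
      exact hx _ (Submodule.subset_span ⟨(⟨u, hu⟩, j), rfl⟩)
    -- All real components of ⟨u|x⟩ vanish, hence so does its squared modulus.
    have h := sum_re_scalarBasis_sq (inner D u x)
    simp only [h0] at h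
    obtain ⟨r, -, hr⟩ := exists_star_mul_self (inner D u x)
    rw [hr, re_algebraMap] at h
    rw [← h] at hr
    simpa using hr
  exact ⟨HilbertBasis.mkOfOrthogonalEqBot ho hbot, fun p => by
    rw [HilbertBasis.coe_mkOfOrthogonalEqBot]⟩

/-! #### Adjoints -/

theorem adjoint_inner_right (T : Op D H) (x y : H) :
    inner D x (adjoint T y) = inner D (T x) y := by
  rw [← star_rinner, adjoint_inner_left, star_rinner]

theorem eq_adjoint {S T : Op D H} (h : ∀ x y, inner D (S x) y = inner D x (T y)) :
    S = adjoint T := by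
  ext x
  exact rinner_ext_left (D := D) fun z => by rw [h, adjoint_inner_left]

theorem adjoint_adjoint (T : Op D H) : adjoint (adjoint T) = T :=
  (eq_adjoint fun x y => (adjoint_inner_right T x y).symm).symm

theorem adjoint_mul (S T : Op D H) : adjoint (S * T) = adjoint T * adjoint S :=
  (eq_adjoint fun x y => by
    change inner D (adjoint T (adjoint S x)) y = inner D x (S (T y))
    rw [adjoint_inner_left, adjoint_inner_left]).symm

theorem adjoint_add (S T : Op D H) : adjoint (S + T) = adjoint S + adjoint T :=
  (eq_adjoint fun x y => by
    change inner D (adjoint S x + adjoint T x) y = inner D x (S y + T y)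
    rw [rinner_add_left, rinner_add, adjoint_inner_left, adjoint_inner_left]).symm

theorem adjoint_real_smul (r : ℝ) (T : Op D H) : adjoint (r • T) = r • adjoint T :=
  (eq_adjoint fun x y => by
    change inner D (r • adjoint T x) y = inner D x (r • T y)
    rw [rinner_real_smul_left, rinner_real_smul, adjoint_inner_left]).symm

theorem real_adjoint (T : Op D H) :
    letI := realInner D (H := H)
    ContinuousLinearMap.adjoint (T.restrictScalars ℝ) = (adjoint T).restrictScalars ℝ := by
  let := realInner D (H := H)
  symm
  rw [ContinuousLinearMap.eq_adjoint_iff]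
  intro x y
  exact congrArg re (adjoint_inner_left T x y)

/-- Both sides are ⟨x|T*T y⟩. This is the link needed to test trace bounds on T itself instead of
|T|. -/
theorem rinner_absOp (T : Op D H) (x y : H) :
    inner D (absOp T x) (absOp T y) = inner D (T x) (T y) := by
  obtain ⟨h1, -, h2⟩ := absOp_spec T
  rw [← adjoint_inner_left, h1, ← adjoint_inner_left T]
  exact congrArg (fun S : Op D H => inner D (S x) y) h2

/-! #### Eigenvalues -/

theorem algebraMap_mem_pointSpectrum {P : Op D H} {s : ℝ} {u : H} (hu : u ≠ 0)
    (h : P u = s • u) : algebraMap ℝ D s ∈ pointSpectrum P := by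
  unfold pointSpectrum
  split_ifs
  · exact ⟨u, hu, by rw [h, real_smul_eq (D := D)]⟩
  · intro hinj
    refine hu (hinj ?_)
    rw [map_zero]
    change P (P u) - (2 * re (algebraMap ℝ D s)) • P u
      + re (star (algebraMap ℝ D s) * algebraMap ℝ D s) • u = 0
    have h' : P (s • u) = s • P u := (P.restrictScalars ℝ).map_smul s u
    rw [h, h', h, star_algebraMap, ← map_mul, re_algebraMap, re_algebraMap,
      smul_smul, smul_smul, ← sub_smul, ← add_smul]
    convert! zero_smul ℝ u
    ring

/-- For commutative `D`, ⟨u|Pu⟩ = ‖u‖² q is real and nonnegative. In the spherical case put a = re q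
and t = |q - a|², so |q|² = t + a²; pairing Δ_q(P)u = 0 with u gives ‖Pu - au‖² + t‖u‖² = 0. Both
terms vanish, so q = a is a genuine eigenvalue. -/
theorem exists_of_mem_pointSpectrum {P : Op D H} (hP : adjoint P = P) (hpos : IsPositive P)
    {q : D} (hq : q ∈ pointSpectrum P) :
    ∃ s : ℝ, 0 ≤ s ∧ q = algebraMap ℝ D s ∧ ∃ u ≠ 0, P u = s • u := by
  have key : ∀ (s : ℝ) (u : H), u ≠ 0 → P u = s • u → 0 ≤ s := by
    intro s u hu h
    obtain ⟨r, hr, h1⟩ := hpos u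
    rw [h, rinner_real_smul, rinner_self, Algebra.smul_def, ← map_mul, algebraMap_inj] at h1
    have : 0 < ‖u‖ ^ 2 := by positivity
    nlinarith
  unfold pointSpectrum at hq
  split_ifs at hq with hc
  · obtain ⟨u, hu, h⟩ := hq
    obtain ⟨r, hr, h1⟩ := hpos u
    have hu2 : ‖u‖ ^ 2 ≠ 0 := by positivity
    rw [h, rinner_smul, rinner_self] at h1
    have hqs : q = algebraMap ℝ D ((‖u‖ ^ 2)⁻¹ * r) := by
      rw [map_mul, ← h1, ← mul_assoc, ← map_mul, inv_mul_cancel₀ hu2, map_one, one_mul]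
    have hPu : P u = ((‖u‖ ^ 2)⁻¹ * r) • u := by rw [h, real_smul_eq (D := D), ← hqs]
    exact ⟨_, key _ u hu hPu, hqs, u, hu, hPu⟩
  · have hinj : ∃ u ≠ 0, sphericalOp P q u = 0 := by
      by_contra! hne
      refine hq ((injective_iff_map_eq_zero (sphericalOp P q)).2 fun u hu => ?_)
      by_contra hu0
      exact hne u hu0 hu
    obtain ⟨u, hu, h⟩ := hinj
    set a := re q with ha
    obtain ⟨t, ht, htq⟩ := exists_star_mul_self (q - algebraMap ℝ D a)
    have hqq : re (star q * q) = t + a ^ 2 := by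
      have e : star q + q = (2 : ℝ) • algebraMap ℝ D a := by
        rw [algebraMap_re, smul_smul, add_comm]; norm_num
      have e2 : star q * q = star (q - algebraMap ℝ D a) * (q - algebraMap ℝ D a)
          + algebraMap ℝ D a * (star q + q) - algebraMap ℝ D (a * a) := by
        rw [star_sub, star_algebraMap, map_mul, mul_add, sub_mul, mul_sub, mul_sub,
          Algebra.commutes a (star q), Algebra.commutes a q]
        abel
      rw [e2, e, htq, mul_smul_comm, ← map_mul, re_sub, re_add, re_smul, re_algebraMap,
        re_algebraMap]
      ring
    let := realInner D (H := H)
    have hsym : inner ℝ u (P (P u)) = ‖P u‖ ^ 2 := by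
      rw [← real_inner_self_eq_norm_sq]
      change re (inner D u (P (P u))) = re (inner D (P u) (P u))
      rw [← adjoint_inner_left, hP]
    have h0 : inner ℝ u (P (P u) - (2 * a) • P u + re (star q * q) • u) = 0 := by
      have : P (P u) - (2 * a) • P u + re (star q * q) • u = 0 := h
      rw [this, inner_zero_right]
    rw [inner_add_right, inner_sub_right, real_inner_smul_right, real_inner_smul_right, hsym,
      real_inner_self_eq_norm_sq, hqq] at h0
    have h2 := norm_sub_sq_real (P u) (a • u)
    rw [real_inner_smul_right, real_inner_comm, norm_smul, mul_pow, Real.norm_eq_abs, sq_abs] at h2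
    have h3 : ‖P u - a • u‖ ^ 2 + t * ‖u‖ ^ 2 = 0 := by rw [h2]; linarith
    have hu2 : 0 < ‖u‖ ^ 2 := by positivity
    have h4 : ‖P u - a • u‖ ^ 2 = 0 := by nlinarith [sq_nonneg ‖P u - a • u‖]
    have h5 : t = 0 := by
      rw [h4, zero_add] at h3
      exact (mul_eq_zero.1 h3).resolve_right hu2.ne'
    have hPu : P u = a • u := by
      rw [← sub_eq_zero, ← norm_eq_zero]
      exact pow_eq_zero_iff two_ne_zero |>.1 h4
    refine ⟨a, key a u hu hPu, ?_, u, hu, hPu⟩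
    rw [h5, map_zero] at htq
    rw [← sub_eq_zero]
    rcases mul_eq_zero.1 htq with h6 | h6
    · exact star_eq_zero.1 h6
    · exact h6

/-- The real dimension of an eigenspace is its dimension over `D` times `dim D`. -/
theorem toENat_rank_eigenspace (P : Op D H) (s : ℝ) :
    Cardinal.toENat (Module.rank ℝ (Module.End.eigenspace (P.restrictScalars ℝ).toLinearMap s))
      = (Module.finrank ℝ D : ℕ∞) * eigenDim P s := by
  have he : Module.End.eigenspace (P.restrictScalars ℝ).toLinearMap s
      = (eigenspace P s).restrictScalars ℝ := by
    ext u
    rw [Module.End.mem_eigenspace_iff, Submodule.restrictScalars_mem, mem_eigenspace]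
    rfl
  rw [he]
  have := finiteDimensional_scalar D
  -- Tower law for ℝ ⊆ Dᵐᵒᵖ, with lifts because `D` and `H` live in different universes.
  have h : Cardinal.lift.{v} (Module.rank ℝ Dᵐᵒᵖ) * Cardinal.lift.{u} (Module.rank Dᵐᵒᵖ (eigenspace P s))
      = Cardinal.lift.{u} (Module.rank ℝ (eigenspace P s)) := lift_rank_mul_lift_rank _ _ _
  have h2 := congrArg Cardinal.toENat h
  rw [map_mul, Cardinal.toENat_lift, Cardinal.toENat_lift, Cardinal.toENat_lift,
    ← (opLinearEquiv ℝ (M := D)).rank_eq, ← Module.finrank_eq_rank, Cardinal.toENat_nat] at h2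
  exact h2.symm

theorem eigenDim_ne_zero_iff {P : Op D H} {s : ℝ} :
    eigenDim P s ≠ 0 ↔ ∃ u ≠ 0, P u = s • u := by
  rw [eigenDim, Ne, Cardinal.toENat_eq_zero, Submodule.rank_eq_zero, ← Ne,
    Submodule.ne_bot_iff]
  simp only [mem_eigenspace]
  exact ⟨fun ⟨u, h1, h2⟩ => ⟨u, h2, h1⟩, fun ⟨u, h1, h2⟩ => ⟨u, h2, h1⟩⟩

end Hilbert

end RCH

namespace RCH

section TraceClass

universe u v

variable {D : Type u} [DivisionRing D] [StarRing D] [Algebra ℝ D] [IsScalar D]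
variable {H : Type v} [NormedAddCommGroup H] [NormedSpace ℝ H] [CompleteSpace H] [Module Dᵐᵒᵖ H]
  [RightInnerProductSpace D H]

open RightInnerProductSpace

/-! #### Compactness of adjoints and absolute values -/

theorem isCompactOperator_of_norm_sq_le {S T : Op D H} (hT : IsCompactOperator T)
    (h : ∀ x, ‖S x‖ ^ 2 ≤ ‖x‖ * ‖T x‖) : IsCompactOperator S := by
  let := realInner D (H := H)
  exact RealTrace.isCompactOperator_of_norm_sq_le (S := S.restrictScalars ℝ)
    (T := T.restrictScalars ℝ) hT h

theorem norm_sq_le_adjoint_mul (T : Op D H) (x : H) :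
    ‖T x‖ ^ 2 ≤ ‖x‖ * ‖(adjoint T * T) x‖ := by
  let := realInner D (H := H)
  rw [← re_rinner_self (D := D), ← adjoint_inner_right]
  exact real_inner_le_norm x ((adjoint T * T) x)

theorem isCompactOperator_mul_left {T : Op D H} (hT : IsCompactOperator T) (B : Op D H) :
    IsCompactOperator (B * T : Op D H) := hT.clm_comp B

theorem isCompactOperator_mul_right {T : Op D H} (hT : IsCompactOperator T) (B : Op D H) :
    IsCompactOperator (T * B : Op D H) := hT.comp_clm B

theorem isCompactOperator_adjoint {T : Op D H} (hT : IsCompactOperator T) :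
    IsCompactOperator (adjoint T) := by
  refine isCompactOperator_of_norm_sq_le (isCompactOperator_mul_right hT (adjoint T)) fun x => ?_
  have := norm_sq_le_adjoint_mul (adjoint T) x
  rwa [adjoint_adjoint] at this

theorem isCompactOperator_absOp_iff {T : Op D H} :
    IsCompactOperator (absOp T) ↔ IsCompactOperator T := by
  obtain ⟨h1, -, h2⟩ := absOp_spec T
  constructor
  · intro h
    refine isCompactOperator_of_norm_sq_le (isCompactOperator_mul_left h (absOp T)) fun x => ?_
    rw [h2]
    exact norm_sq_le_adjoint_mul T x
  · intro h
    refine isCompactOperator_of_norm_sq_le (isCompactOperator_mul_left h (adjoint T)) fun x => ?_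
    rw [← h2]
    conv_rhs => rw [← h1]
    simpa [h1] using norm_sq_le_adjoint_mul (absOp T) x

/-! #### The trace over a Hilbert basis -/

theorem inner_absOp (T : Op D H) (u : H) :
    0 ≤ absDiag T u ∧ inner D u (absOp T u) = algebraMap ℝ D (absDiag T u) := by
  obtain ⟨r, hr, h⟩ := (absOp_spec T).2.1 u
  rw [absDiag, h, re_algebraMap]
  exact ⟨hr, rfl⟩

theorem absOp_isSymmetric (T : Op D H) :
    letI := realInner D (H := H)
    ((absOp T).restrictScalars ℝ).toLinearMap.IsSymmetric := by
  let := realInner D (H := H)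
  intro x y
  change re (inner D (absOp T x) y) = re (inner D x (absOp T y))
  rw [← adjoint_inner_left, (absOp_spec T).1]

/-- Right linearity of |T| and reality of ⟨u||T|u⟩ make each of the d vectors obtained from u
contribute exactly ⟨u||T|u⟩. -/
theorem tsum_absDiag (T : Op D H) {M : Set H} :
    letI := realInner D (H := H)
    ∀ b : HilbertBasis (M × Fin (Module.finrank ℝ D)) ℝ H,
      (∀ p, b p = op (scalarBasis D p.2) • (p.1 : H)) →
      ∑' p, ENNReal.ofReal (inner ℝ (b p) ((absOp T).restrictScalars ℝ (b p)))
        = Module.finrank ℝ D * ∑' u : M, ENNReal.ofReal (absDiag T u) := by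
  let := realInner D (H := H)
  intro b hb
  have h : ∀ p, inner ℝ (b p) ((absOp T).restrictScalars ℝ (b p)) = absDiag T p.1 := by
    intro p
    rw [hb]
    change re (inner D (op (scalarBasis D p.2) • (p.1 : H))
      (absOp T (op (scalarBasis D p.2) • (p.1 : H)))) = _
    rw [map_smul, re_rinner_scalarBasis (inner_absOp T p.1).2, if_pos rfl, mul_one]
  simp only [h]
  rw [ENNReal.tsum_prod', ← ENNReal.tsum_mul_left]
  refine tsum_congr fun u => ?_
  simp

theorem summable_absDiag_iff {T : Op D H} {M : Set H} :
    (Summable fun u : M => absDiag T u) ↔ ∑' u : M, ENNReal.ofReal (absDiag T u) ≠ ⊤ := by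
  refine ⟨fun h => ?_, fun h => ?_⟩
  · rw [← ENNReal.ofReal_tsum_of_nonneg (fun u => (inner_absOp T _).1) h]
    exact ENNReal.ofReal_ne_top
  · exact (ENNReal.summable_toReal h).congr fun u => ENNReal.toReal_ofReal (inner_absOp T _).1

theorem isCompactOperator_of_mem_traceClass {T : Op D H} (hT : T ∈ traceClass D H) :
    IsCompactOperator T := by
  obtain ⟨N, hN, hsum⟩ := hT
  rw [← isCompactOperator_absOp_iff]
  let := realInner D (H := H)
  obtain ⟨b, hb⟩ := hN.exists_real
  refine RealTrace.isCompactOperator_of_trace (P := (absOp T).restrictScalars ℝ)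
    (absOp_isSymmetric T) (fun x => (inner_absOp T x).1) b ?_
  rw [tsum_absDiag T b hb]
  exact ENNReal.mul_ne_top (ENNReal.natCast_ne_top _) (summable_absDiag_iff.1 hsum)

/-- Real s outside the point spectrum have zero eigenspace, so the sum may run over all of ℝ; each
real multiplicity is d times the one over D. -/
theorem eigenTrace_absOp (T : Op D H) :
    letI := realInner D (H := H)
    RealTrace.eigenTrace ((absOp T).restrictScalars ℝ) = Module.finrank ℝ D * eTraceNorm T := by
  let := realInner D (H := H)
  have hsupp : Function.support (fun s : ℝ => ENNReal.ofReal s * (eigenDim (absOp T) s : ℝ≥0∞))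
      ⊆ {s : ℝ | algebraMap ℝ D s ∈ pointSpectrum (absOp T)} := by
    intro s hs
    have h0 : eigenDim (absOp T) s ≠ 0 := by
      rintro h
      simp [h] at hs
    obtain ⟨u, hu, h⟩ := eigenDim_ne_zero_iff.1 h0
    exact algebraMap_mem_pointSpectrum hu h
  have he : eTraceNorm T = ∑' s : ℝ, ENNReal.ofReal s * (eigenDim (absOp T) s : ℝ≥0∞) :=
    tsum_subtype_eq_of_support_subset hsupp
  rw [he, ← ENNReal.tsum_mul_left, RealTrace.eigenTrace]
  refine tsum_congr fun s => ?_
  rw [toENat_rank_eigenspace, ENat.toENNReal_mul, mul_left_comm]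
  rfl

variable (D) in
theorem finrank_scalar_ne_zero : (Module.finrank ℝ D : ℝ≥0∞) ≠ 0 :=
  Nat.cast_ne_zero.2 (finrank_scalar_pos D).ne'

variable (D) in
theorem finrank_scalar_pos' : (0 : ℝ) < Module.finrank ℝ D :=
  Nat.cast_pos.2 (finrank_scalar_pos D)

theorem tsum_absDiag_eq_eTraceNorm {T : Op D H} (hT : IsCompactOperator T) {M : Set H}
    (hM : IsHilbertBasis D M) : ∑' u : M, ENNReal.ofReal (absDiag T u) = eTraceNorm T := by
  let := realInner D (H := H)
  obtain ⟨b, hb⟩ := hM.exists_real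
  have h := (RealTrace.eigenTrace_spec (P := (absOp T).restrictScalars ℝ)
    (isCompactOperator_absOp_iff.2 hT) (absOp_isSymmetric T) (fun x => (inner_absOp T x).1)).1 b
  rw [tsum_absDiag T b hb, eigenTrace_absOp] at h
  exact (ENNReal.mul_right_inj (finrank_scalar_ne_zero D) (ENNReal.natCast_ne_top _)).1 h

theorem mem_traceClass_iff {T : Op D H} :
    T ∈ traceClass D H ↔ IsCompactOperator T ∧ eTraceNorm T < ⊤ := by
  constructor
  · intro h
    have hc := isCompactOperator_of_mem_traceClass h
    obtain ⟨N, hN, hsum⟩ := h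
    refine ⟨hc, ?_⟩
    rw [← tsum_absDiag_eq_eTraceNorm hc hN]
    exact (summable_absDiag_iff.1 hsum).lt_top
  · rintro ⟨hc, h⟩
    obtain ⟨N, hN⟩ := exists_isHilbertBasis D H
    refine ⟨N, hN, summable_absDiag_iff.2 ?_⟩
    rw [tsum_absDiag_eq_eTraceNorm hc hN]
    exact h.ne

theorem hasSum_absDiag {T : Op D H} (hT : T ∈ traceClass D H) {M : Set H}
    (hM : IsHilbertBasis D M) : HasSum (fun u : M => absDiag T u) (traceNorm T) := by
  obtain ⟨hc, h⟩ := mem_traceClass_iff.1 hT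
  have hs := tsum_absDiag_eq_eTraceNorm hc hM
  have hsum : Summable fun u : M => absDiag T u := by
    rw [summable_absDiag_iff, hs]
    exact h.ne
  rw [traceNorm, ← hs, ← ENNReal.ofReal_tsum_of_nonneg (fun u => (inner_absOp T _).1) hsum,
    ENNReal.toReal_ofReal (tsum_nonneg fun u : M => (inner_absOp T (u : H)).1)]
  exact hsum.hasSum

theorem eigenDim_absOp {T : Op D H} (hT : IsCompactOperator T) {s : ℝ}
    (hs : algebraMap ℝ D s ∈ pointSpectrum (absOp T)) :
    1 ≤ eigenDim (absOp T) s ∧ (s ≠ 0 → eigenDim (absOp T) s < ⊤) := by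
  constructor
  · obtain ⟨t, -, hts, h⟩ := exists_of_mem_pointSpectrum (absOp_spec T).1 (absOp_spec T).2.1 hs
    rw [algebraMap_inj.1 hts, Order.one_le_iff_ne_zero]
    exact eigenDim_ne_zero_iff.2 h
  · intro h0
    let := realInner D (H := H)
    have := ((absOp T).restrictScalars ℝ).finite_dimensional_eigenspace
      (isCompactOperator_absOp_iff.2 hT) s h0
    have h := toENat_rank_eigenspace (absOp T) s
    rw [← Module.finrank_eq_rank, Cardinal.toENat_nat] at h
    by_contra! htop
    rw [top_le_iff.1 htop, ENat.mul_top (Nat.cast_ne_zero.2 (finrank_scalar_pos D).ne')] at h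
    exact ENat.natCast_ne_top _ h

/-! #### The variational characterization -/

/-- `∑ Re ⟨eᵢ|T fᵢ⟩ ≤ c` for all finite Bessel families `e` and `f` of the underlying real Hilbert
space. -/
def TrBound (T : Op D H) (c : ℝ) : Prop :=
  letI := realInner D (H := H)
  RealTrace.TrBound (T.restrictScalars ℝ) c

/-- The left side no longer mentions |T|, so it is additive and stable under composition.
Compactness is essential: without it the eigenvalue sum misses continuous spectrum. -/
theorem trBound_iff {T : Op D H} (hT : IsCompactOperator T) {c : ℝ} (hc : 0 ≤ c) :
    TrBound T c ↔ Module.finrank ℝ D * eTraceNorm T ≤ ENNReal.ofReal c := by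
  let := realInner D (H := H)
  rw [← eigenTrace_absOp]
  exact (RealTrace.eigenTrace_spec (P := (absOp T).restrictScalars ℝ)
    (isCompactOperator_absOp_iff.2 hT) (absOp_isSymmetric T) (fun x => (inner_absOp T x).1)).2
    (T.restrictScalars ℝ) (fun x y => congrArg re (rinner_absOp T x y).symm) c hc

theorem traceNorm_nonneg (T : Op D H) : 0 ≤ traceNorm T := ENNReal.toReal_nonneg

theorem trBound_traceNorm {T : Op D H} (hT : T ∈ traceClass D H) :
    TrBound T (Module.finrank ℝ D * traceNorm T) := by
  obtain ⟨hc, h⟩ := mem_traceClass_iff.1 hT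
  rw [trBound_iff hc (mul_nonneg (Nat.cast_nonneg _) (traceNorm_nonneg T)),
    ENNReal.ofReal_mul (Nat.cast_nonneg _), ENNReal.ofReal_natCast, traceNorm,
    ENNReal.ofReal_toReal h.ne]

theorem TrBound.mem_traceClass {T : Op D H} {c : ℝ} (h : TrBound T (Module.finrank ℝ D * c))
    (hT : IsCompactOperator T) : T ∈ traceClass D H ∧ traceNorm T ≤ c := by
  let := realInner D (H := H)
  have h0 : 0 ≤ (Module.finrank ℝ D : ℝ) * c := RealTrace.TrBound.nonneg h
  have hc0 : 0 ≤ c := nonneg_of_mul_nonneg_right h0 (finrank_scalar_pos' D)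
  rw [trBound_iff hT h0, ENNReal.ofReal_mul (Nat.cast_nonneg _), ENNReal.ofReal_natCast,
    ENNReal.mul_le_mul_iff_right (finrank_scalar_ne_zero D) (ENNReal.natCast_ne_top _)] at h
  refine ⟨mem_traceClass_iff.2 ⟨hT, h.trans_lt ENNReal.ofReal_lt_top⟩, ?_⟩
  exact ENNReal.toReal_le_of_le_ofReal hc0 h

/-- Test the bound on the normalized vectors Tx and x, each multiplied by all d basis scalars. Every
term equals ‖Tx‖/‖x‖, and the d terms absorb the factor d in the bound; a single pair would lose it.
-/
theorem opNorm_le_traceNorm {T : Op D H} (hT : T ∈ traceClass D H) :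
    opNorm T ≤ traceNorm T := by
  let := realInner D (H := H)
  refine ContinuousLinearMap.opNorm_le_bound _ (traceNorm_nonneg T) fun x => ?_
  change ‖T x‖ ≤ _
  rcases eq_or_ne (T x) 0 with hTx | hTx
  · rw [hTx, norm_zero]
    exact mul_nonneg (traceNorm_nonneg T) (norm_nonneg x)
  have hx : x ≠ 0 := by
    rintro rfl
    exact hTx (map_zero T)
  have horth : ∀ z : H, z ≠ 0 → Orthonormal ℝ fun j : Fin (Module.finrank ℝ D) =>
      op (scalarBasis D j) • (‖z‖⁻¹ • z) := by
    intro z hz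
    rw [orthonormal_iff_ite]
    intro i j
    refine (re_rinner_scalarBasis (r := 1) ?_ i j).trans (one_mul _)
    rw [rinner_self, norm_smul, norm_inv, norm_norm, inv_mul_cancel₀ (norm_ne_zero_iff.2 hz),
      one_pow]
  have h := RealTrace.TrBound.sum_le (trBound_traceNorm hT) (horth _ hTx).isBessel
    (horth _ hx).isBessel
  have hi : inner D (‖T x‖⁻¹ • T x) (T (‖x‖⁻¹ • x)) = algebraMap ℝ D (‖x‖⁻¹ * ‖T x‖) := by
    have : T (‖x‖⁻¹ • x) = ‖x‖⁻¹ • T x := (T.restrictScalars ℝ).map_smul _ _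
    rw [this, rinner_real_smul, rinner_real_smul_left, rinner_self, Algebra.smul_def,
      Algebra.smul_def, ← map_mul, ← map_mul]
    congr 2
    field_simp
  have hj : ∀ j : Fin (Module.finrank ℝ D), inner ℝ (op (scalarBasis D j) • (‖T x‖⁻¹ • T x))
      (T.restrictScalars ℝ (op (scalarBasis D j) • (‖x‖⁻¹ • x))) = ‖x‖⁻¹ * ‖T x‖ := by
    intro j
    change re (inner D _ (T _)) = _
    rw [map_smul, re_rinner_scalarBasis hi, if_pos rfl, mul_one]
  simp only [hj, Finset.sum_const, Finset.card_univ, Fintype.card_fin, nsmul_eq_mul] at h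
  have h1 := le_of_mul_le_mul_left h (finrank_scalar_pos' D)
  rw [inv_mul_le_iff₀ (norm_pos_iff.2 hx)] at h1
  linarith

/-! #### The ideal of trace-class operators -/

theorem traceClass_add {S T : Op D H} (hS : S ∈ traceClass D H) (hT : T ∈ traceClass D H) :
    S + T ∈ traceClass D H ∧ traceNorm (S + T) ≤ traceNorm S + traceNorm T := by
  let := realInner D (H := H)
  refine TrBound.mem_traceClass ?_ ((isCompactOperator_of_mem_traceClass hS).add
    (isCompactOperator_of_mem_traceClass hT))
  have h := RealTrace.TrBound.add (trBound_traceNorm hS) (trBound_traceNorm hT)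
  rw [← mul_add] at h
  have e : (S + T).restrictScalars ℝ = S.restrictScalars ℝ + T.restrictScalars ℝ := by
    ext x
    rfl
  rw [TrBound, e]
  exact h

theorem traceClass_zero : (0 : Op D H) ∈ traceClass D H ∧ traceNorm (0 : Op D H) ≤ 0 := by
  let := realInner D (H := H)
  refine TrBound.mem_traceClass ?_ isCompactOperator_zero
  rw [mul_zero]
  exact RealTrace.trBound_zero

theorem traceClass_adjoint {T : Op D H} (hT : T ∈ traceClass D H) :
    adjoint T ∈ traceClass D H ∧ traceNorm (adjoint T) ≤ traceNorm T := by
  let := realInner D (H := H)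
  refine TrBound.mem_traceClass ?_
    (isCompactOperator_adjoint (isCompactOperator_of_mem_traceClass hT))
  have h := RealTrace.TrBound.adjoint (trBound_traceNorm hT)
  rwa [real_adjoint] at h

theorem traceNorm_adjoint {T : Op D H} (hT : T ∈ traceClass D H) :
    traceNorm (adjoint T) = traceNorm T := by
  have h := traceClass_adjoint hT
  have h2 := (traceClass_adjoint h.1).2
  rw [adjoint_adjoint] at h2
  exact le_antisymm h.2 h2

/-- The bound is tested in the real space, so C need only be real-linear; left multiplication and
scalar multiplication are both covered. -/
theorem traceClass_comp_left {S T : Op D H} (hT : T ∈ traceClass D H) {C : H →L[ℝ] H}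
    (hS : ∀ x, S x = C (T x)) :
    S ∈ traceClass D H ∧ traceNorm S ≤ ‖C‖ * traceNorm T := by
  let := realInner D (H := H)
  have hST : S.restrictScalars ℝ = C * T.restrictScalars ℝ := by
    ext x
    exact hS x
  have hco : (S : H → H) = C ∘ T := funext hS
  refine TrBound.mem_traceClass ?_ ?_
  · have h := RealTrace.TrBound.comp_left (trBound_traceNorm hT) C
    rw [← hST] at h
    rwa [mul_left_comm]
  · rw [hco]
    exact (isCompactOperator_of_mem_traceClass hT).continuous_comp C.continuous

theorem traceClass_mul_left {T : Op D H} (hT : T ∈ traceClass D H) (B : Op D H) :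
    B * T ∈ traceClass D H ∧ traceNorm (B * T) ≤ traceNorm T * opNorm B := by
  rw [mul_comm]
  exact traceClass_comp_left hT (C := B.restrictScalars ℝ) fun x => rfl

theorem traceClass_mul_right {T : Op D H} (hT : T ∈ traceClass D H) (B : Op D H) :
    T * B ∈ traceClass D H ∧ traceNorm (T * B) ≤ traceNorm T * opNorm B := by
  let := realInner D (H := H)
  refine TrBound.mem_traceClass ?_
    (isCompactOperator_mul_right (isCompactOperator_of_mem_traceClass hT) B)
  rw [← mul_assoc]
  exact RealTrace.TrBound.comp_right (trBound_traceNorm hT) (B.restrictScalars ℝ)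

/-- The ideal inequality applied in both directions turns into an equality. This gives homogeneity
of the norm for real and complex scalars alike. -/
theorem traceClass_scale {S T : Op D H} (hT : T ∈ traceClass D H) {C C' : H →L[ℝ] H} {t : ℝ}
    (ht : 0 < t) (hS : ∀ x, S x = C (T x)) (hT' : ∀ x, T x = C' (S x)) (hC : ‖C‖ ≤ t)
    (hC' : ‖C'‖ ≤ t⁻¹) : S ∈ traceClass D H ∧ traceNorm S = t * traceNorm T := by
  have h1 := traceClass_comp_left hT hS
  have h2 := traceClass_comp_left h1.1 hT'
  refine ⟨h1.1, le_antisymm ?_ ?_⟩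
  · exact h1.2.trans (mul_le_mul_of_nonneg_right hC (traceNorm_nonneg T))
  · rw [← le_inv_mul_iff₀ ht]
    exact h2.2.trans (mul_le_mul_of_nonneg_right hC' (traceNorm_nonneg S))

theorem traceClass_real_smul {T : Op D H} (hT : T ∈ traceClass D H) (r : ℝ) :
    r • T ∈ traceClass D H ∧ traceNorm (r • T) = ‖r‖ * traceNorm T := by
  rcases eq_or_ne r 0 with rfl | hr
  · rw [zero_smul, norm_zero, zero_mul]
    exact ⟨traceClass_zero.1, le_antisymm traceClass_zero.2 (traceNorm_nonneg _)⟩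
  have hn : ∀ a : ℝ, ‖a • (1 : H →L[ℝ] H)‖ ≤ ‖a‖ := fun a =>
    ContinuousLinearMap.opNorm_le_bound _ (norm_nonneg a) fun x => (norm_smul a x).le
  refine traceClass_scale hT (C := r • 1) (C' := r⁻¹ • 1) (norm_pos_iff.2 hr) (fun x => rfl)
    (fun x => ?_) (hn r) ((hn _).trans_eq (norm_inv r))
  change T x = r⁻¹ • r • T x
  rw [inv_smul_smul₀ hr]

theorem traceNorm_eq_zero_iff {T : Op D H} (hT : T ∈ traceClass D H) :
    traceNorm T = 0 ↔ T = 0 := by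
  constructor
  · intro h
    have h1 := opNorm_le_traceNorm hT
    rw [h] at h1
    have h2 : T.restrictScalars ℝ = 0 := norm_le_zero_iff.1 h1
    ext x
    exact congrArg (fun F : H →L[ℝ] H => F x) h2
  · rintro rfl
    exact le_antisymm traceClass_zero.2 (traceNorm_nonneg _)

theorem neg_one_smul_op (T : Op D H) : (-1 : ℝ) • T = -T := by
  ext x
  exact neg_one_smul ℝ (T x)

theorem traceClass_sub {S T : Op D H} (hS : S ∈ traceClass D H) (hT : T ∈ traceClass D H) :
    S - T ∈ traceClass D H := by
  have h := (traceClass_add hS (traceClass_real_smul hT (-1)).1).1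
  rwa [neg_one_smul_op, ← sub_eq_add_neg] at h

theorem traceNorm_sub_comm {S T : Op D H} (hS : S ∈ traceClass D H) (hT : T ∈ traceClass D H) :
    traceNorm (S - T) = traceNorm (T - S) := by
  have h := (traceClass_real_smul (traceClass_sub hT hS) (-1)).2
  rwa [neg_one_smul_op, neg_sub, norm_neg, norm_one, one_mul] at h

/-- The trace norm dominates the operator norm, so there is a compact limit y in operator norm. The
bounds for x m - x n pass to the pointwise limit m → ∞ and control y - x n. -/
theorem traceClass_complete (x : ℕ → Op D H) (hx : ∀ n, x n ∈ traceClass D H)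
    (hcau : ∀ ε > 0, ∃ n₀, ∀ m ≥ n₀, ∀ n ≥ n₀, traceNorm (x m - x n) < ε) :
    ∃ y ∈ traceClass D H, ∀ ε > 0, ∃ n₀, ∀ n ≥ n₀, traceNorm (x n - y) < ε := by
  let := realInner D (H := H)
  let A : ℕ → H →L[ℝ] H := fun n => (x n).restrictScalars ℝ
  have hA : CauchySeq A := by
    refine Metric.cauchySeq_iff.2 fun ε hε => ?_
    obtain ⟨n₀, h⟩ := hcau ε hε
    refine ⟨n₀, fun m hm n hn => ?_⟩
    rw [dist_eq_norm]
    exact (opNorm_le_traceNorm (traceClass_sub (hx m) (hx n))).trans_lt (h m hm n hn)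
  obtain ⟨Y, hY⟩ := cauchySeq_tendsto_of_complete hA
  have hYx : ∀ z, Filter.Tendsto (fun n => x n z) Filter.atTop (nhds (Y z)) := fun z =>
    ((ContinuousLinearMap.apply ℝ H z).continuous.tendsto Y).comp hY
  let y : Op D H := ⟨⟨⟨Y, map_add Y⟩, fun q z => by
    refine tendsto_nhds_unique (hYx (q • z)) ?_
    simp only [map_smul]
    exact (hYx z).const_smul q⟩, Y.continuous⟩
  have hyc : IsCompactOperator y :=
    isClosed_setOfPred_isCompactOperator.mem_of_tendsto hY
      (Filter.Eventually.of_forall fun n => isCompactOperator_of_mem_traceClass (hx n))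
  have key : ∀ ε > 0, ∃ n₀, ∀ n ≥ n₀,
      y - x n ∈ traceClass D H ∧ traceNorm (y - x n) ≤ ε := by
    intro ε hε
    obtain ⟨n₀, h⟩ := hcau ε hε
    refine ⟨n₀, fun n hn => TrBound.mem_traceClass ?_
      (hyc.sub (isCompactOperator_of_mem_traceClass (hx n)))⟩
    refine RealTrace.TrBound.of_tendsto (S := fun m => (x m - x n).restrictScalars ℝ) ?_
      fun z => (hYx z).sub_const (x n z)
    filter_upwards [Filter.eventually_ge_atTop n₀] with m hm
    exact RealTrace.TrBound.mono (trBound_traceNorm (traceClass_sub (hx m) (hx n)))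
      (mul_le_mul_of_nonneg_left (h m hm n hn).le (Nat.cast_nonneg _))
  have hy : y ∈ traceClass D H := by
    obtain ⟨n₀, h⟩ := key 1 one_pos
    have := (traceClass_add (h n₀ le_rfl).1 (hx n₀)).1
    rwa [sub_add_cancel] at this
  refine ⟨y, hy, fun ε hε => ?_⟩
  -- Passing to the limit only gives `≤`; halving ε restores the strict inequality.
  obtain ⟨n₀, h⟩ := key (ε / 2) (by positivity)
  refine ⟨n₀, fun n hn => ?_⟩
  rw [traceNorm_sub_comm (hx n) hy]
  linarith [(h n hn).2]

variable (D H) in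
-- Only homogeneity depends on the scalar ring, so the real and complex cases share the rest.
theorem isBanachSpace_traceClass_of_norm_smul {𝕜 : Type*} [NormedRing 𝕜] [Module 𝕜 (Op D H)]
    (h : ∀ (c : 𝕜), ∀ T ∈ traceClass D H,
      c • T ∈ traceClass D H ∧ traceNorm (c • T) = ‖c‖ * traceNorm T) :
    IsBanachSpace 𝕜 (traceClass D H) traceNorm where
  zero_mem := traceClass_zero.1
  add_mem _ hS _ hT := (traceClass_add hS hT).1
  smul_mem c T hT := (h c T hT).1
  norm_nonneg T _ := traceNorm_nonneg T
  norm_eq_zero _ hT := traceNorm_eq_zero_iff hT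
  norm_add_le _ hS _ hT := (traceClass_add hS hT).2
  norm_smul c T hT := (h c T hT).2
  complete := traceClass_complete

end TraceClass

/-! ### The complex-linear structure for D = ℂ. -/

section Complex

variable {H : Type*} [NormedAddCommGroup H] [NormedSpace ℝ H] [CompleteSpace H] [Module ℂᵐᵒᵖ H]
  [RightInnerProductSpace ℂ H]

open RightInnerProductSpace

theorem norm_op_smul (c : ℂᵐᵒᵖ) (x : H) : ‖c • x‖ = ‖c‖ * ‖x‖ := by
  rw [← sq_eq_sq₀ (norm_nonneg _) (by positivity), mul_pow]
  have h := norm_smul_sq (D := ℂ) x c.unop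
  rw [op_unop] at h
  have h2 : star c.unop * c.unop = algebraMap ℝ ℂ (‖c‖ ^ 2) := by
    rw [← MulOpposite.norm_unop c]
    simpa using Complex.conj_mul' c.unop
  rw [h, h2, re_algebraMap, mul_comm]

theorem traceClass_complex_smul {T : Op ℂ H} (hT : T ∈ traceClass ℂ H) (c : ℂᵐᵒᵖ) :
    c • T ∈ traceClass ℂ H ∧ traceNorm (c • T) = ‖c‖ * traceNorm T := by
  rcases eq_or_ne c 0 with rfl | hc
  · rw [zero_smul, norm_zero, zero_mul]
    exact ⟨traceClass_zero.1, le_antisymm traceClass_zero.2 (traceNorm_nonneg _)⟩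
  let C : ℂᵐᵒᵖ → H →L[ℝ] H := fun a =>
    { toFun := fun x => a • x
      map_add' := smul_add a
      map_smul' := fun r x => (smul_comm r a x).symm
      cont := continuous_const_smul a }
  have hn : ∀ a, ‖C a‖ ≤ ‖a‖ := fun a =>
    ContinuousLinearMap.opNorm_le_bound _ (norm_nonneg a) fun x => (norm_op_smul a x).le
  refine traceClass_scale hT (C := C c) (C' := C c⁻¹) (norm_pos_iff.2 hc) (fun x => rfl)
    (fun x => ?_) (hn c) ((hn _).trans_eq (norm_inv c.unop))
  change T x = c⁻¹ • c • T x
  rw [inv_smul_smul₀ hc]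

theorem adjoint_complex_smul (c : ℂ) (T : Op ℂ H) :
    adjoint (op c • T) = op (star c) • adjoint T :=
  (eq_adjoint fun x y => by
    change inner ℂ (op (star c) • adjoint T x) y = inner ℂ x (op c • T y)
    rw [rinner_smul_left, rinner_smul, star_star, adjoint_inner_left, mul_comm]).symm

end Complex

end RCH

open RCH in
theorem proposition2p1 :
    -- `H` is a real, complex or quaternionic Hilbert space
    (∀ (D : Type*) [DivisionRing D] [StarRing D] [Algebra ℝ D] [IsScalar D]
      (H : Type*) [NormedAddCommGroup H] [NormedSpace ℝ H] [CompleteSpace H] [Module Dᵐᵒᵖ H]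
      [RightInnerProductSpace D H],
      -- (a)
      (∀ T ∈ traceClass D H,
        (∀ M : Set H, IsHilbertBasis D M → Summable fun u : M => absDiag T u) ∧
        (∀ M M' : Set H, IsHilbertBasis D M → IsHilbertBasis D M' →
          ∑' u : M, absDiag T u = ∑' u : M', absDiag T u)) ∧
      -- (b)
      (∀ T : Op D H, T ∈ traceClass D H ↔ IsCompactOperator T ∧ eTraceNorm T < ⊤) ∧
      (∀ T : Op D H, IsCompactOperator T →
        (∀ q ∈ pointSpectrum (absOp T), ∃ s : ℝ, 0 ≤ s ∧ q = algebraMap ℝ D s) ∧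
        (∀ s : ℝ, algebraMap ℝ D s ∈ pointSpectrum (absOp T) →
          1 ≤ eigenDim (absOp T) s ∧ (s ≠ 0 → eigenDim (absOp T) s < ⊤))) ∧
      -- (c)
      (∀ T ∈ traceClass D H, ∀ M : Set H, IsHilbertBasis D M →
        HasSum (fun u : M => absDiag T u) (traceNorm T)) ∧
      -- (d)
      IsBanachSpace ℝ (traceClass D H) traceNorm ∧
      (∀ A ∈ traceClass D H, adjoint A ∈ traceClass D H ∧
        ∀ B : Op D H, A * B ∈ traceClass D H ∧ B * A ∈ traceClass D H) ∧
      -- (e)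
      (∀ A ∈ traceClass D H,
        (∀ B : Op D H, traceNorm (A * B) ≤ traceNorm A * opNorm B ∧
          traceNorm (B * A) ≤ traceNorm A * opNorm B) ∧
        traceNorm A = traceNorm (adjoint A) ∧
        opNorm A ≤ traceNorm A) ∧
      -- Banach `*`-algebra
      (∀ A ∈ traceClass D H, ∀ B ∈ traceClass D H,
        traceNorm (A * B) ≤ traceNorm A * traceNorm B ∧
        adjoint (adjoint A) = A ∧ adjoint (A * B) = adjoint B * adjoint A ∧
        adjoint (A + B) = adjoint A + adjoint B ∧
        ∀ a : ℝ, adjoint (a • A) = a • adjoint A)) ∧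
    -- for complex `H` the structures are complex; the operator `op c • A` is `x ↦ (A x) c`
    (∀ (H : Type*) [NormedAddCommGroup H] [NormedSpace ℝ H] [CompleteSpace H] [Module ℂᵐᵒᵖ H]
      [RightInnerProductSpace ℂ H],
      IsBanachSpace ℂᵐᵒᵖ (traceClass ℂ H) traceNorm ∧
      ∀ A ∈ traceClass ℂ H, ∀ c : ℂ,
        adjoint (MulOpposite.op c • A) = MulOpposite.op (star c) • adjoint A) := by
  refine ⟨?_, ?_⟩
  · intro D _ _ _ _ H _ _ _ _ _
    refine ⟨fun T hT => ⟨fun M hM => (hasSum_absDiag hT hM).summable, fun M M' hM hM' => ?_⟩,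
      fun T => mem_traceClass_iff, fun T hT => ⟨fun q hq => ?_, fun s hs => eigenDim_absOp hT hs⟩,
      fun T hT M hM => hasSum_absDiag hT hM,
      isBanachSpace_traceClass_of_norm_smul D H fun c T hT => traceClass_real_smul hT c,
      fun A hA => ⟨(traceClass_adjoint hA).1, fun B =>
        ⟨(traceClass_mul_right hA B).1, (traceClass_mul_left hA B).1⟩⟩,
      fun A hA => ⟨fun B => ⟨(traceClass_mul_right hA B).2, (traceClass_mul_left hA B).2⟩,
        (traceNorm_adjoint hA).symm, opNorm_le_traceNorm hA⟩,
      fun A hA B hB => ⟨?_, adjoint_adjoint A, adjoint_mul A B, adjoint_add A B,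
        fun a => adjoint_real_smul a A⟩⟩
    · rw [(hasSum_absDiag hT hM).tsum_eq, (hasSum_absDiag hT hM').tsum_eq]
    · obtain ⟨s, hs, hq, -⟩ :=
        exists_of_mem_pointSpectrum (absOp_spec T).1 (absOp_spec T).2.1 hq
      exact ⟨s, hs, hq⟩
    -- Submultiplicativity combines the ideal inequality with ‖B‖ ≤ ‖B‖₁.
    · exact (traceClass_mul_right hA B).2.trans
        (mul_le_mul_of_nonneg_left (opNorm_le_traceNorm hB) (traceNorm_nonneg A))
  · intro H _ _ _ _ _
    exact ⟨isBanachSpace_traceClass_of_norm_smul ℂ H fun c T hT => traceClass_complex_smul hT c,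
      fun A _ c => adjoint_complex_smul c A⟩
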